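/- Strings are the elements of $\omega^{<\omega}$; $\sigma\subseteq\tau$ means that $\tau$ extends $\sigma$ (not necessarily properly), and two strings are incompatible if neither extends the other. Let $\Phi_e$ be the $e$-th computable functional. For $f\in\omega^\omega$, $\Phi_e(f)$ is the partial function $n\mapsto\Phi_e(f;n)$; for a string $\tau$, $\Phi_e(\tau)$ is the longest string $\rho$ with $|\rho|\le|\tau|$ such that, for all $n<|\rho|$, $\rho(n)$ is the value of the computation $\Phi_e(\tau;n)$, which converges within $|\tau|$ steps. Strings $\tau_0,\tau_1$ form an $e$-splitting if $\Phi_e(\tau_0)$ and $\Phi_e(\tau_1)$ are incompatible. An f-tree is a partial function $T$ from strings to strings whose domain is closed under initial segments, which respects $\subseteq$ and the lexicographic order, and for which, for every $\sigma\in\operatorname{dom}T$, the entry of $T(\sigma^\frown\langle n\rangle)$ at position $|T(\sigma)|$ exists and is strictly increasing in $n$ (over those $n$ with $\sigma^\frown\langle n\rangle\in\operatorname{dom}T$). Its nodes are the elements of $\operatorname{rng}T$, and $[T]$ is the set of paths through $T$, i.e. of all functions $\bigcup_n T(g\restriction n)$ with $g\in\omega^\omega$ and $g\restriction n\in\operatorname{dom}T$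 for all $n$. $T$ is pruned if every node is extended by a path, perfect if $[T]$ has no isolated points, and weakly $\omega$-branching if every non-terminal $\sigma\in\operatorname{dom}T$ has infinitely many immediate successors in $\operatorname{dom}T$. Proposition. There is a computable function $h$ such that, whenever $i$ is an index with $T=\Phi_i(0')$ for a perfect, weakly $\omega$-branching, pruned f-tree $T$ (so $T\le_T 0'$, with strings coded by numbers), the computable functional $\Phi_e$ with $e=h(i)$ satisfies: (1) $e$-splittings occur above every node of $T$: for every $\tau\in\operatorname{rng}T$ there are $\tau_0,\tau_1\in\operatorname{rng}T$, both extending $\tau$, that form an $e$-splitting; (2) for every $\tau\in\operatorname{rng}T$ there are paths $f\ne g$ in $[T]$, both extending $\tau$, such that $\Phi_e(f)$ and $\Phi_e(g)$ are total and $\Phi_e(f)=\Phi_e(g)$. -/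

import Mathlib

open Nat.Partrec (Code)

/-! ### Strings and infinite sequences -/

/-- The initial segment of length `k` of a function `X : ℕ → ℕ`. -/
def initSeg (X : ℕ → ℕ) (k : ℕ) : List ℕ := (List.range k).map X

/-- The string `σ` is an initial segment of the function `X`. -/
def IsInitSegOf (σ : List ℕ) (X : ℕ → ℕ) : Prop := initSeg X σ.length = σ

/-- Two strings are incompatible if neither extends the other. -/
def Incompatible (σ τ : List ℕ) : Prop := ¬ σ <+: τ ∧ ¬ τ <+: σ

/-! ### Computable functionals

The `e`-th computable functional is given by Kleene's normal form.  The `e`-th partial recursive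
function `φ_e` acts on pairs (string, number); a computation `y = ⟨u, t⟩` from a string `σ` at
argument `n` is the run of `φ_e` for `t` steps at the pair `(σ ↾ u, n)`.  The least halting `y`
determines the output.  As `u ≤ y`, the computation `y` needs only the first `y` values of the
oracle. -/

/-- `{e}_s(σ; n)` for `s = |σ|`: the output, if any, of the first halting computation
`y = ⟨u, t⟩ < |σ|` of the `e`-th functional at argument `n` with oracle string `σ`. -/
def evalString (e : ℕ) (σ : List ℕ) (n : ℕ) : Option ℕ :=
  (List.range σ.length).findSome? fun y =>
    Code.evaln y.unpair.2 (Denumerable.ofNat Code e)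
      (Nat.pair (Encodable.encode (σ.take y.unpair.1)) n)

/-- `{e}(X)`: the `e`-th computable functional applied to the function `X`, a partial function
whose value at `n` is found by searching for the first initial segment of `X` on which the
computation converges. -/
def functional (e : ℕ) (X : ℕ → ℕ) : ℕ →. ℕ := fun n =>
  Nat.rfindOpt fun k => evalString e (initSeg X k) n

/-- `{e}(σ)` for a string `σ`: the longest string `τ` with `|τ| ≤ |σ|` such that
`τ(n) = {e}_s(σ; n)`, where `s = |σ|`, for all `n < |τ|`. -/
def functionalString (e : ℕ) (σ : List ℕ) : List ℕ :=
  (((List.range σ.length).map (evalString e σ)).takeWhile Option.isSome).reduceOption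

/-- The strings `σ`, `τ` form an `e`-splitting. -/
def ESplit (e : ℕ) (σ τ : List ℕ) : Prop :=
  Incompatible (functionalString e σ) (functionalString e τ)

@[simp] theorem initSeg_length (X : ℕ → ℕ) (k : ℕ) : (initSeg X k).length = k := by simp [initSeg]

theorem initSeg_take (X : ℕ → ℕ) {u k : ℕ} (h : u ≤ k) : (initSeg X k).take u = initSeg X u := by
  simp [initSeg, ← List.map_take, List.take_range, h]

theorem evalString_initSeg_isSome {e : ℕ} {X : ℕ → ℕ} {k n m : ℕ}
    (h : m ∈ evalString e (initSeg X k) n) :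
    ∃ u, m ∈ Code.eval (Denumerable.ofNat Code e) (Nat.pair (Encodable.encode (initSeg X u)) n) := by
  obtain ⟨y, hy, hm⟩ := List.exists_of_findSome?_eq_some h
  simp only [initSeg_length, List.mem_range] at hy
  refine ⟨y.unpair.1, ?_⟩
  rw [initSeg_take X ((Nat.unpair_left_le y).trans hy.le)] at hm
  exact Code.evaln_sound hm

theorem exists_uniform_of_recursiveIn (X : ℕ → ℕ) {f : ℕ →. ℕ}
    (hf : Nat.RecursiveIn {(X : ℕ →. ℕ)} f) :
    ∃ F : List ℕ × ℕ →. ℕ, Partrec F ∧ ∀ n,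
      (∀ k m, m ∈ F (initSeg X k, n) → m ∈ f n) ∧
      (∀ m ∈ f n, ∃ k₀, ∀ k ≥ k₀, m ∈ F (initSeg X k, n)) := by
  have base : ∀ {f : ℕ →. ℕ}, Nat.Partrec f → ∃ F : List ℕ × ℕ →. ℕ, Partrec F ∧ ∀ n,
      (∀ k m, m ∈ F (initSeg X k, n) → m ∈ f n) ∧
      (∀ m ∈ f n, ∃ k₀, ∀ k ≥ k₀, m ∈ F (initSeg X k, n)) := fun {f} hf =>
    ⟨fun p => f p.2, (Partrec.nat_iff.2 hf).comp Computable.snd,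
      fun n => ⟨fun _ _ h => h, fun m h => ⟨0, fun _ _ => h⟩⟩⟩
  induction hf with
  | zero => exact base .zero
  | succ => exact base .succ
  | left => exact base .left
  | right => exact base .right
  | oracle g hg =>
    cases hg
    refine ⟨fun p => (p.1[p.2]? : Option ℕ),
      (Primrec.list_getElem?.to_comp.comp Computable.fst Computable.snd).ofOption, fun n => ?_⟩
    have key : ∀ k, n < k → (initSeg X k)[n]? = some (X n) := fun k hk => by simp [initSeg, hk]
    refine ⟨fun k m h => ?_, fun m h => ⟨n + 1, fun k hk => ?_⟩⟩
    · simp only [Part.mem_ofOption, Option.mem_def] at h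
      have hn : n < k := by
        by_contra hc
        simp [initSeg, hc] at h
      rw [key k hn] at h
      simp_all
    · simp only [PFun.coe_val, Part.mem_some_iff] at h
      simp [key k hk, h]
  | @pair f g _ _ ihf ihg =>
    obtain ⟨F, hF, HF⟩ := ihf
    obtain ⟨G, hG, HG⟩ := ihg
    refine ⟨fun p => (F p).bind fun a => (G p).map fun b => Nat.pair a b,
      hF.bind ((hG.comp Computable.fst).map
        ((Primrec₂.natPair.to_comp.comp (Computable.snd.comp Computable.fst) Computable.snd).to₂)),
      fun n => ⟨fun k m h => ?_, fun m h => ?_⟩⟩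
    · simp only [Part.mem_bind_iff, Part.mem_map_iff] at h
      obtain ⟨a, ha, b, hb, rfl⟩ := h
      simp only [Seq.seq, Part.map_eq_map, Part.mem_bind_iff, Part.mem_map_iff]
      exact ⟨_, ⟨a, (HF n).1 k a ha, rfl⟩, b, (HG n).1 k b hb, rfl⟩
    · simp only [Seq.seq, Part.map_eq_map, Part.mem_bind_iff, Part.mem_map_iff] at h
      obtain ⟨_, ⟨a, ha, rfl⟩, b, hb, rfl⟩ := h
      obtain ⟨k₁, h₁⟩ := (HF n).2 a ha
      obtain ⟨k₂, h₂⟩ := (HG n).2 b hb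
      refine ⟨max k₁ k₂, fun k hk => ?_⟩
      simp only [Part.mem_bind_iff, Part.mem_map_iff]
      exact ⟨a, h₁ k (le_trans (le_max_left _ _) hk), b, h₂ k (le_trans (le_max_right _ _) hk), rfl⟩
  | @comp f g _ _ ihf ihg =>
    obtain ⟨F, hF, HF⟩ := ihf
    obtain ⟨G, hG, HG⟩ := ihg
    refine ⟨fun p => (G p).bind fun a => F (p.1, a),
      hG.bind ((hF.comp ((Computable.fst.comp Computable.fst).pair Computable.snd)).to₂),
      fun n => ⟨fun k m h => ?_, fun m h => ?_⟩⟩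
    · obtain ⟨a, ha, hm⟩ := Part.mem_bind_iff.1 h
      exact Part.mem_bind_iff.2 ⟨a, (HG n).1 k a ha, (HF a).1 k m hm⟩
    · obtain ⟨a, ha, hm⟩ := Part.mem_bind_iff.1 h
      obtain ⟨k₁, h₁⟩ := (HG n).2 a ha
      obtain ⟨k₂, h₂⟩ := (HF a).2 m hm
      exact ⟨max k₁ k₂, fun k hk => Part.mem_bind_iff.2
        ⟨a, h₁ k (le_trans (le_max_left _ _) hk), h₂ k (le_trans (le_max_right _ _) hk)⟩⟩
  | @prec f g _ _ ihf ihg =>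
    obtain ⟨F, hF, HF⟩ := ihf
    obtain ⟨G, hG, HG⟩ := ihg
    refine ⟨fun p => Nat.rec (F (p.1, p.2.unpair.1)) (fun y IH => IH.bind fun i =>
        G (p.1, Nat.pair p.2.unpair.1 (Nat.pair y i))) p.2.unpair.2, ?_, fun p => ?_⟩
    · have c1 : Computable fun p : List ℕ × ℕ => p.2.unpair.1 :=
        (Primrec.fst.comp (Primrec.unpair.comp Primrec.snd)).to_comp
      have c2 : Computable fun p : List ℕ × ℕ => p.2.unpair.2 :=
        (Primrec.snd.comp (Primrec.unpair.comp Primrec.snd)).to_comp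
      refine Partrec.nat_rec (h := fun p q => G (p.1, Nat.pair p.2.unpair.1 (Nat.pair q.1 q.2)))
        c2 (hF.comp (Computable.fst.pair c1)) ?_
      exact (hG.comp ((Computable.fst.comp Computable.fst).pair
        (Primrec₂.natPair.to_comp.comp (c1.comp Computable.fst)
          (Primrec₂.natPair.to_comp.comp (Computable.fst.comp Computable.snd)
            (Computable.snd.comp Computable.snd))))).to₂
    · simp only []
      generalize p.unpair.1 = a
      generalize p.unpair.2 = n
      induction n with
      | zero => exact HF a
      | succ n ih =>
        refine ⟨fun k m h => ?_, fun m h => ?_⟩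
        · obtain ⟨i, hi, hm⟩ := Part.mem_bind_iff.1 h
          exact Part.mem_bind_iff.2 ⟨i, ih.1 k i hi, (HG _).1 k m hm⟩
        · obtain ⟨i, hi, hm⟩ := Part.mem_bind_iff.1 h
          obtain ⟨k₁, h₁⟩ := ih.2 i hi
          obtain ⟨k₂, h₂⟩ := (HG _).2 m hm
          exact ⟨max k₁ k₂, fun k hk => Part.mem_bind_iff.2
            ⟨i, h₁ k (le_trans (le_max_left _ _) hk), h₂ k (le_trans (le_max_right _ _) hk)⟩⟩
  | @rfind f _ ihf =>
    obtain ⟨F, hF, HF⟩ := ihf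
    refine ⟨fun p => Nat.rfind fun n => (fun m => decide (m = 0)) <$> F (p.1, Nat.pair p.2 n),
      Partrec.rfind ?_, fun a => ⟨fun k m h => ?_, fun m h => ?_⟩⟩
    · refine ((hF.comp ((Computable.fst.comp Computable.fst).pair
        (Primrec₂.natPair.to_comp.comp (Computable.snd.comp Computable.fst)
          Computable.snd))).map (f := fun p : (List ℕ × ℕ) × ℕ => F (p.1.1, Nat.pair p.1.2 p.2))
        (g := fun _ m => decide (m = 0)) ?_)
      exact (Primrec.eq.decide.comp Primrec.snd (Primrec.const 0)).to_comp.to₂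
    · replace h := Nat.mem_rfind.1 h
      refine Nat.mem_rfind.2 ?_
      simp only [Part.map_eq_map, Part.mem_map_iff] at h ⊢
      exact ⟨h.1.imp fun x hx => ⟨(HF _).1 k x hx.1, hx.2⟩,
        fun {j} hj => (h.2 hj).imp fun x hx => ⟨(HF _).1 k x hx.1, hx.2⟩⟩
    · replace h := Nat.mem_rfind.1 h
      simp only [Part.map_eq_map, Part.mem_map_iff] at h
      have hall : ∀ j, ∃ k₀, j ≤ m → ∀ k ≥ k₀, ∃ x, x ∈ F (initSeg X k, Nat.pair a j) ∧
          decide (x = 0) = decide (j = m) := by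
        intro j
        rcases lt_trichotomy j m with hj | rfl | hj
        · obtain ⟨x, hx, hx0⟩ := h.2 hj
          obtain ⟨k₁, h₁⟩ := (HF _).2 x hx
          exact ⟨k₁, fun _ k hk => ⟨x, h₁ k hk, by simp [hx0, hj.ne]⟩⟩
        · obtain ⟨x, hx, hx0⟩ := h.1
          obtain ⟨k₁, h₁⟩ := (HF _).2 x hx
          exact ⟨k₁, fun _ k hk => ⟨x, h₁ k hk, by simp [hx0]⟩⟩
        · exact ⟨0, fun h' => absurd h' (not_le.2 hj)⟩
      choose K hK using hall
      refine ⟨(Finset.range (m + 1)).sup K, fun k hk => ?_⟩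
      have hK' : ∀ j ≤ m, K j ≤ k := fun j hj =>
        (Finset.le_sup (f := K) (Finset.mem_range.2 (Nat.lt_succ_of_le hj))).trans hk
      refine Nat.mem_rfind.2 ?_
      simp only [Part.map_eq_map, Part.mem_map_iff]
      refine ⟨?_, fun {j} hj => ?_⟩
      · obtain ⟨x, hx, hx0⟩ := hK m le_rfl k (hK' m le_rfl)
        exact ⟨x, hx, by simpa using hx0⟩
      · obtain ⟨x, hx, hx0⟩ := hK j hj.le k (hK' j hj.le)
        exact ⟨x, hx, by simpa [hj.ne] using hx0⟩

/-- Every partial function computable in `X` has an index. -/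
theorem exists_functional_eq_of_turingReducible (X : ℕ → ℕ) {f : ℕ →. ℕ}
    (hf : TuringReducible f X) : ∃ e, functional e X = f := by
  obtain ⟨F, hF, H⟩ := exists_uniform_of_recursiveIn X (RecursiveIn.iff_nat.1 hf)
  obtain ⟨c, hc⟩ := Code.exists_code.1 hF
  have hev : ∀ σ n, Code.eval c (Nat.pair (Encodable.encode σ) n) = F (σ, n) := by
    intro σ n
    have : Nat.pair (Encodable.encode σ) n = Encodable.encode (σ, n) := by simp
    rw [hc, this]
    simp only [Encodable.encodek, Part.coe_some, Part.bind_some]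
    exact Part.map_id' (fun _ => rfl) _
  have hsound : ∀ n m, m ∈ functional (Encodable.encode c) X n → m ∈ f n := by
    intro n m h
    obtain ⟨k, hk⟩ := Nat.rfindOpt_spec h
    obtain ⟨u, hu⟩ := evalString_initSeg_isSome hk
    rw [Denumerable.ofNat_encode, hev] at hu
    exact (H n).1 u m hu
  refine ⟨Encodable.encode c, funext fun n => Part.ext fun m => ⟨hsound n m, fun h => ?_⟩⟩
  obtain ⟨k, hk⟩ := (H n).2 m h
  have h1 := hk k le_rfl
  rw [← hev, Code.evaln_complete] at h1
  obtain ⟨t, ht⟩ := h1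
  have hdom : (functional (Encodable.encode c) X n).Dom := by
    refine Nat.rfindOpt_dom.2 ⟨Nat.pair k t + 1, ?_⟩
    simp only [Option.mem_def, ← Option.isSome_iff_exists, evalString, List.findSome?_isSome_iff]
    refine ⟨Nat.pair k t, by simp, ?_⟩
    rw [initSeg_take X (by simpa using (Nat.left_le_pair k t).trans (Nat.le_succ _))]
    simp only [Nat.unpair_pair, Denumerable.ofNat_encode]
    exact Option.isSome_iff_exists.2 ⟨m, ht⟩
  obtain ⟨m', hm'⟩ := Part.dom_iff_mem.1 hdom
  rwa [Part.mem_unique h (hsound n m' hm')]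

theorem computable_evalString (e : ℕ) :
    Computable fun p : List ℕ × ℕ => evalString e p.1 p.2 := by
  have hb : Primrec fun q : (List ℕ × ℕ) × ℕ =>
      Code.evaln q.2.unpair.2 (Denumerable.ofNat Code e)
        (Nat.pair (Encodable.encode (q.1.1.take q.2.unpair.1)) q.1.2) := by
    refine Code.primrec_evaln.comp (Primrec.pair (Primrec.pair
      (Primrec.snd.comp (Primrec.unpair.comp Primrec.snd)) (Primrec.const _)) ?_)
    refine Primrec₂.natPair.comp (Primrec.encode.comp ?_) (Primrec.snd.comp Primrec.fst)
    exact Primrec.list_take.comp (Primrec.fst.comp (Primrec.unpair.comp Primrec.snd)) (Primrec.fst.comp Primrec.fst)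
  have : Primrec fun p : List ℕ × ℕ => (((List.range p.1.length).filterMap fun y =>
      Code.evaln y.unpair.2 (Denumerable.ofNat Code e)
        (Nat.pair (Encodable.encode (p.1.take y.unpair.1)) p.2)).head? : Option ℕ) :=
    Primrec.list_head?.comp (Primrec.listFilterMap
      (Primrec.list_range.comp (Primrec.list_length.comp Primrec.fst)) hb.to₂)
  refine this.to_comp.of_eq fun p => ?_
  simp only [evalString, List.head?_filterMap]

/-- A computable functional applied to `X` yields a partial function computable in `X`. -/
theorem turingReducible_functional (e : ℕ) (X : ℕ → ℕ) : TuringReducible (functional e X) X := by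
  rw [TuringReducible, RecursiveIn.iff_nat]
  let R : (ℕ → ℕ) → Prop := fun g => Nat.RecursiveIn {(X : ℕ →. ℕ)} (fun n => Part.some (g n))
  have ofComp : ∀ {g : ℕ → ℕ}, Computable g → R g := fun hg =>
    (Partrec.nat_iff.1 hg.partrec).recursiveIn
  have comp : ∀ {g h : ℕ → ℕ}, R g → R h → R fun n => g (h n) := fun hg hh =>
    (Nat.RecursiveIn.comp hg hh).of_eq fun n => Part.bind_some _ _
  have pair : ∀ {g h : ℕ → ℕ}, R g → R h → R fun n => Nat.pair (g n) (h n) := fun hg hh =>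
    (Nat.RecursiveIn.pair hg hh).of_eq fun n => by simp [Seq.seq]
  have hX : R X := Nat.RecursiveIn.oracle _ rfl
  have hu1 : Primrec fun p : ℕ => p.unpair.1 := Primrec.fst.comp Primrec.unpair
  have hu2 : Primrec fun p : ℕ => p.unpair.2 := Primrec.snd.comp Primrec.unpair
  have happ : Primrec fun p : ℕ => Encodable.encode
      (Denumerable.ofNat (List ℕ) p.unpair.2 ++ [p.unpair.1]) :=
    Primrec.encode.comp (Primrec.list_append.comp ((Primrec.ofNat _).comp hu2)
      (Primrec.list_cons.comp hu1 (Primrec.const [])))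
  have hstep : R fun p => Encodable.encode (Denumerable.ofNat (List ℕ) p.unpair.2.unpair.2 ++
      [X p.unpair.2.unpair.1]) := by
    have := comp (ofComp happ.to_comp) (pair (comp hX (ofComp (hu1.comp hu2).to_comp))
      (ofComp (hu2.comp hu2).to_comp))
    simpa only [Nat.unpair_pair] using this
  have hseg : R fun p => Encodable.encode (initSeg X p.unpair.2) := by
    refine (Nat.RecursiveIn.prec (ofComp (Computable.const (Encodable.encode ([] : List ℕ))))
      hstep).of_eq fun p => ?_
    simp only []
    generalize p.unpair.1 = a
    generalize p.unpair.2 = n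
    induction n with
    | zero => rfl
    | succ n ih =>
      refine (congrArg (fun z : Part ℕ => z.bind _) ih).trans ?_
      refine (Part.bind_some _ _).trans ?_
      simp [initSeg, List.range_succ]
  have hev : R fun p => Encodable.encode (evalString e (initSeg X p.unpair.2) p.unpair.1) := by
    have hc : Computable fun p : ℕ => Encodable.encode
        (evalString e (Denumerable.ofNat (List ℕ) p.unpair.1) p.unpair.2) :=
      Computable.encode.comp (Computable.comp (f := fun q : List ℕ × ℕ => evalString e q.1 q.2)
        (g := fun p : ℕ => (Denumerable.ofNat (List ℕ) p.unpair.1, p.unpair.2))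
        (computable_evalString e)
        (((Primrec.ofNat _).comp hu1).pair hu2).to_comp)
    have := comp (ofComp hc) (pair hseg (ofComp hu1.to_comp))
    simpa only [Nat.unpair_pair, Denumerable.ofNat_encode] using this
  have hr := Nat.RecursiveIn.rfind (comp (ofComp (g := fun v => 1 - v)
    (Primrec.nat_sub.comp (Primrec.const 1) Primrec.id).to_comp) hev)
  have hp := Nat.RecursiveIn.comp (comp (ofComp Primrec.pred.to_comp) hev)
    (Nat.RecursiveIn.pair (ofComp Computable.id) hr)
  refine hp.of_eq fun n => ?_
  have hfind : (Nat.rfind fun k => (fun m => decide (m = 0)) <$> (Part.some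
      (1 - Encodable.encode (evalString e (initSeg X (Nat.pair n k).unpair.2)
        (Nat.pair n k).unpair.1)))) =
      Nat.rfind fun k => Part.some (evalString e (initSeg X k) n).isSome := by
    congr 1
    funext k
    rw [Part.map_eq_map, Part.map_some, Nat.unpair_pair]
    cases h : evalString e (initSeg X k) n <;> simp
  refine Part.ext fun m => ?_
  refine Part.mem_bind_iff.trans (Iff.trans ?_ Part.mem_bind_iff.symm)
  rw [hfind]
  simp only [Seq.seq, Part.map_eq_map, Part.map_some, Part.bind_some, Part.mem_map_iff, id]
  constructor
  · rintro ⟨_, ⟨b, hb, rfl⟩, hm⟩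
    have hs := Part.mem_some_iff.1 (Nat.rfind_spec hb)
    obtain ⟨w, hw⟩ := Option.isSome_iff_exists.1 hs.symm
    exact ⟨b, hb, by simpa [hw] using hm⟩
  · rintro ⟨b, hb, hm⟩
    refine ⟨_, ⟨b, hb, rfl⟩, ?_⟩
    simp only [Part.mem_ofOption, Option.mem_def] at hm
    simp [hm]

/-- The numbering is adequate: the partial functions of the form `{e}(X)` are exactly those that
are computable in `X`. -/
theorem turingReducible_iff_exists_functional (X : ℕ → ℕ) (f : ℕ →. ℕ) :
    TuringReducible f X ↔ ∃ e, functional e X = f :=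
  ⟨exists_functional_eq_of_turingReducible X, fun ⟨e, he⟩ => he ▸ turingReducible_functional e X⟩

open Classical in
/-- The characteristic function of the halting set `0'`. -/
noncomputable def zeroJump : ℕ → ℕ := fun e =>
  if (Code.eval (Denumerable.ofNat Code e) e).Dom then 1 else 0

/-! ### f-trees -/

/-- An f-tree: a partial function from strings to strings, with a domain closed under initial
segments, that respects extension and the lexicographic order and preserves longest common initial
segments: the entry of `T(σ⌢⟨n⟩)` at position `|T(σ)|` exists and strictly increases with `n`. -/
structure FTree where
  /-- the underlying partial function -/
  toPFun : List ℕ →. List ℕ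
  dom_closed : ∀ {σ σ' : List ℕ}, σ <+: σ' → (toPFun σ').Dom → (toPFun σ).Dom
  prefix_respecting : ∀ {σ σ' τ τ' : List ℕ}, σ <+: σ' → τ ∈ toPFun σ → τ' ∈ toPFun σ' → τ <+: τ'
  lex_respecting : ∀ {σ σ' τ τ' : List ℕ}, σ < σ' → τ ∈ toPFun σ → τ' ∈ toPFun σ' → τ < τ'
  length_lt : ∀ {σ τ τ' : List ℕ} {n : ℕ}, τ ∈ toPFun σ → τ' ∈ toPFun (σ ++ [n]) →
    τ.length < τ'.length
  entry_strictMono : ∀ {σ τ τ₁ τ₂ : List ℕ} {n₁ n₂ a₁ a₂ : ℕ}, n₁ < n₂ → τ ∈ toPFun σ →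
    τ₁ ∈ toPFun (σ ++ [n₁]) → τ₂ ∈ toPFun (σ ++ [n₂]) →
    τ₁[τ.length]? = some a₁ → τ₂[τ.length]? = some a₂ → a₁ < a₂

namespace FTree

/-- The range of an f-tree, i.e. its set of nodes. -/
def range (T : FTree) : Set (List ℕ) := {τ | ∃ σ, τ ∈ T.toPFun σ}

/-- The set `[T]` of paths through an f-tree: the functions `f = ⋃ₙ T(g ↾ n)` where `g` is a
function all of whose initial segments are in the domain of `T`. -/
def paths (T : FTree) : Set (ℕ → ℕ) :=
  {f | ∃ g : ℕ → ℕ, ∀ n, ∃ τ ∈ T.toPFun (initSeg g n), IsInitSegOf τ f}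

/-- An f-tree is pruned if each of its nodes is extended by a path. -/
def IsPruned (T : FTree) : Prop := ∀ τ ∈ T.range, ∃ f ∈ T.paths, IsInitSegOf τ f

/-- An f-tree is perfect if its set of paths has no isolated points. -/
def IsPerfect (T : FTree) : Prop := Preperfect T.paths

/-- An f-tree is weakly `ω`-branching if every non-terminal element of its domain has infinitely
many immediate successors in the domain. -/
def IsWeaklyOmegaBranching (T : FTree) : Prop :=
  ∀ σ, (T.toPFun σ).Dom → (∃ σ', σ <+: σ' ∧ σ ≠ σ' ∧ (T.toPFun σ').Dom) →
    {n : ℕ | (T.toPFun (σ ++ [n])).Dom}.Infinite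

/-- `T = {i}(X)` (up to coding strings by numbers): the number `i` is an index for computing the
f-tree `T` from `X`. -/
def IsComputedBy (T : FTree) (i : ℕ) (X : ℕ → ℕ) : Prop :=
  ∀ σ : List ℕ, functional i X (Encodable.encode σ) = (T.toPFun σ).map Encodable.encode

end FTree

/-!
The functional maps a string `p ++ [x]` to the image of `p`, extended by a string that is determined
by the stage `x` approximation of `T` and by the image itself (whose code is given by the recursion
theorem).  If `p` is a node, this string is constant for large `x`, so that it is added to the images
of all but finitely many successors of `p`.  Each string in the domain of `T` has a state: either the
node splits against its first successor, or it has a partner whose image it copies.  Two strings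
that are partners in turn grow into two paths with the same image.
-/

/-! The value of `T` at a string is only known in the limit, by way of the approximation to `0'`.
The tree itself supplies the stages: the children of a node `τ` have pairwise distinct entries `x`
at position `|τ|`, so `x` tends to infinity along the infinitely many children. If the map on
strings decides at `τ ++ [x]`, using stage `x`, what to append to the image of `τ`, then all but
finitely many children receive the limit decision (`finite_not_extending`). The finitely many others
are not controlled. By the recursion theorem the decision may inspect the images of actual children.

One such decision gives a splitting: find any child, let `v` be the first entry that it adds to the
image, and append `v + 1`. Cofinitely many children then have images incompatible with that of the
child found (`exists_incompatible_images`).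

Agreement comes from two strings that leapfrog. If the image of `σ` is an initial segment of that of
`π`, let `σ` append the missing part. Cofinitely many children of `σ` then have images extending
that of `π`; choose one other than `π` and exchange the roles (`IsLinked.advance`). The two
sequences of nodes yield distinct paths with the same limit image (`exists_paths_image_agree`).

A node makes only one decision, so the two tasks are shared out by states. Children of a splitting
string start new leapfrogging pairs, and all but at most two children of a leapfrogging string
return to splitting. Hence splitting strings occur above every string of the domain
(`exists_hasState_none`), which gives both conclusions above every node. -/

/-! ### The functional -/

/-- The initial segment of length `s` of the stage `s` approximation of the halting set. -/
def approxJump (s : ℕ) : List ℕ :=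
  (List.range s).map fun e =>
    cond (Code.evaln s (Denumerable.ofNat Code e) e).isSome 1 0

/-- The stage `s` approximation of `Φ (T σ)`, where the code `c` computes `Φ` and `T σ` is computed
by the functional with index `i` from the first `k` values of the oracle. -/
def imageAt (c : Code) (s i k : ℕ) (σ : List ℕ) : Option (List ℕ) :=
  (evalString i ((approxJump s).take k) (Encodable.encode σ)).bind fun q =>
    (Code.evaln s c (Nat.pair i q)).map (Denumerable.ofNat (List ℕ))

/-- The first child of `σ` found at stage `s` that differs from `excl` and whose image extends
`req`, together with its image. -/
def findChild (c : Code) (s i : ℕ) (σ excl req : List ℕ) : Option (List ℕ × List ℕ) :=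
  (List.range s).findSome? fun z =>
    (imageAt c s i z.unpair.2 (σ ++ [z.unpair.1])).bind fun w =>
      if σ ++ [z.unpair.1] ≠ excl ∧ w.take req.length = req then
        some (σ ++ [z.unpair.1], w) else none

/-- One step in the computation of the state of a string.  The state is `none` for a string above
which the image splits, and `some (π, φ)` for a string whose partner is `π` with image `φ`. -/
def stateStep (c : Code) (s i : ℕ) (ρ : List ℕ) (t : Option (List ℕ × List ℕ)) (m : ℕ) :
    Option (Option (List ℕ × List ℕ)) :=
  match t with
  | none => (findChild c s i (ρ ++ [m]) [] []).map some
  | some p => (findChild c s i ρ p.1 p.2).bind fun r =>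
      -- Here `p.1` is the partner of `ρ`, and `r.1` is the child with which `ρ` overtakes it. The
      -- child `r.1` repeats the search by which `p.1` overtakes it in turn. If `p.1` is itself a
      -- child of `ρ`, its new partner is `r.1`. Every other child is released.
      if ρ ++ [m] = r.1 then (findChild c s i p.1 r.1 r.2).map some
      else if ρ ++ [m] = p.1 then some (some r) else some none

/-- The string `σ` together with the stage `s` approximation of its state. -/
def stateAux (c : Code) (s i : ℕ) (σ : List ℕ) : List ℕ × Option (Option (List ℕ × List ℕ)) :=
  σ.foldl (fun a m => (a.1 ++ [m], a.2.bind fun t => stateStep c s i a.1 t m)) ([], some none)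

/-- The stage `s` approximation of the state of `σ`. -/
def stateAt (c : Code) (s i : ℕ) (σ : List ℕ) : Option (Option (List ℕ × List ℕ)) :=
  (stateAux c s i σ).2

/-- The stage `s` approximation of the string `σ` with `T σ = p`. -/
def preimageAt (s i : ℕ) (p : List ℕ) : Option (List ℕ) :=
  (List.range s).findSome? fun z =>
    if evalString i ((approxJump s).take z.unpair.2) z.unpair.1 = some (Encodable.encode p) then
      some (Denumerable.ofNat (List ℕ) z.unpair.1) else none

/-- The string added to the image `φ` of a node `T σ` by its successors, for the state `t` of
`σ`. -/
def stateIncrement (c : Code) (s i : ℕ) (σ φ : List ℕ) (t : Option (List ℕ × List ℕ)) :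
    Option (List ℕ) :=
  match t with
  -- With `excl = []` and `req = []` the search is unrestricted, since no child is the empty string.
  -- Adding one to the first new entry forces a disagreement.
  | none => (findChild c s i σ [] []).map fun r => [(r.2.drop φ.length).headI + 1]
  | some r => some (r.2.drop φ.length)

/-- The string added at stage `s` to the image `φ` of `p`. -/
def increment (c : Code) (s i : ℕ) (p φ : List ℕ) : List ℕ :=
  ((preimageAt s i p).bind fun σ => (stateAt c s i σ).bind fun t =>
    stateIncrement c s i σ φ t).getD []

/-- The string `p` together with its image. -/
def imageAux (c : Code) (i : ℕ) (p : List ℕ) : List ℕ × List ℕ :=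
  -- The entry `x` serves as the stage. The final `0` makes the image grow at every step, even when
  -- the increment is empty, which ensures totality along every oracle.
  p.foldl (fun a x => (a.1 ++ [x], a.2 ++ (increment c x i a.1 a.2 ++ [0]))) ([], [])

/-- The image of the string `p`. -/
def image (c : Code) (i : ℕ) (p : List ℕ) : List ℕ := (imageAux c i p).2

/-! ### Computability -/

section Primrec

variable {α β γ : Type*} [Primcodable α] [Primcodable β] [Primcodable γ]

theorem Primrec.list_findSome? {l : α → List β} {f : α → β → Option γ}
    (hl : Primrec l) (hf : Primrec₂ f) : Primrec fun a => (l a).findSome? (f a) :=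
  (Primrec.list_head?.comp (Primrec.listFilterMap hl hf)).of_eq fun a => by
    rw [List.head?_filterMap]

theorem primrec_evalString {e n : α → ℕ} {σ : α → List ℕ} (he : Primrec e) (hσ : Primrec σ)
    (hn : Primrec n) : Primrec fun a => evalString (e a) (σ a) (n a) := by
  refine Primrec.list_findSome? (Primrec.list_range.comp (Primrec.list_length.comp hσ)) ?_
  have hy1 : Primrec fun q : α × ℕ => q.2.unpair.1 :=
    Primrec.fst.comp (Primrec.unpair.comp Primrec.snd)
  have hy2 : Primrec fun q : α × ℕ => q.2.unpair.2 :=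
    Primrec.snd.comp (Primrec.unpair.comp Primrec.snd)
  exact Code.primrec_evaln.comp (((hy2.pair ((Primrec.ofNat Code).comp (he.comp Primrec.fst))).pair
    (Primrec₂.natPair.comp (Primrec.encode.comp
      (Primrec.list_take.comp hy1 (hσ.comp Primrec.fst))) (hn.comp Primrec.fst))))

theorem primrec_approxJump : Primrec approxJump := by
  refine Primrec.list_map Primrec.list_range ?_
  refine Primrec.cond (Primrec.option_isSome.comp ?_) (Primrec.const 1) (Primrec.const 0)
  exact Code.primrec_evaln.comp ((Primrec.fst.pair ((Primrec.ofNat Code).comp Primrec.snd)).pair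
    Primrec.snd)

theorem primrec_imageAt {c : α → Code} {s i k : α → ℕ} {σ : α → List ℕ} (hc : Primrec c)
    (hs : Primrec s) (hi : Primrec i) (hk : Primrec k) (hσ : Primrec σ) :
    Primrec fun a => imageAt (c a) (s a) (i a) (k a) (σ a) := by
  refine Primrec.option_bind (primrec_evalString hi (Primrec.list_take.comp hk
    (primrec_approxJump.comp hs)) (Primrec.encode.comp hσ)) ?_
  refine Primrec.option_map ?_ ((Primrec.ofNat (List ℕ)).comp Primrec.snd).to₂
  exact Code.primrec_evaln.comp (((hs.comp Primrec.fst).pair (hc.comp Primrec.fst)).pair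
    (Primrec₂.natPair.comp (hi.comp Primrec.fst) Primrec.snd))

theorem Primrec.list_snoc {l : α → List β} {b : α → β} (hl : Primrec l) (hb : Primrec b) :
    Primrec fun a => l a ++ [b a] :=
  Primrec.list_append.comp hl (Primrec.list_cons.comp hb (Primrec.const []))

theorem primrec_findChild {c : α → Code} {s i : α → ℕ} {σ excl req : α → List ℕ} (hc : Primrec c)
    (hs : Primrec s) (hi : Primrec i) (hσ : Primrec σ) (he : Primrec excl) (hr : Primrec req) :
    Primrec fun a => findChild (c a) (s a) (i a) (σ a) (excl a) (req a) := by
  refine Primrec.list_findSome? (Primrec.list_range.comp hs) ?_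
  have hy1 : Primrec fun q : α × ℕ => q.2.unpair.1 :=
    Primrec.fst.comp (Primrec.unpair.comp Primrec.snd)
  have hy2 : Primrec fun q : α × ℕ => q.2.unpair.2 :=
    Primrec.snd.comp (Primrec.unpair.comp Primrec.snd)
  have hch : Primrec fun q : α × ℕ => σ q.1 ++ [q.2.unpair.1] :=
    Primrec.list_snoc (hσ.comp Primrec.fst) hy1
  refine Primrec.option_bind (primrec_imageAt (hc.comp Primrec.fst) (hs.comp Primrec.fst)
    (hi.comp Primrec.fst) hy2 hch) ?_
  have hr' := hr.comp (Primrec.fst.comp (Primrec.fst (α := α × ℕ) (β := List ℕ)))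
  refine Primrec.ite (PrimrecPred.and (PrimrecPred.not
    (Primrec.eq.comp (hch.comp Primrec.fst) (he.comp (Primrec.fst.comp Primrec.fst))))
    (Primrec.eq.comp (Primrec.list_take.comp (Primrec.list_length.comp hr') Primrec.snd) hr'))
    (Primrec.option_some.comp ((hch.comp Primrec.fst).pair Primrec.snd)) (Primrec.const none)

theorem primrec_stateStep {c : α → Code} {s i m : α → ℕ} {ρ : α → List ℕ}
    {t : α → Option (List ℕ × List ℕ)} (hc : Primrec c) (hs : Primrec s) (hi : Primrec i)
    (hρ : Primrec ρ) (ht : Primrec t) (hm : Primrec m) :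
    Primrec fun a => stateStep (c a) (s a) (i a) (ρ a) (t a) (m a) := by
  have hch := Primrec.list_snoc hρ hm
  have h1 : Primrec fun a => (findChild (c a) (s a) (i a) (ρ a ++ [m a]) [] []).map some :=
    Primrec.option_map (primrec_findChild hc hs hi hch (Primrec.const []) (Primrec.const []))
      (Primrec.option_some.comp Primrec.snd).to₂
  have hp : Primrec fun q : α × (List ℕ × List ℕ) => q.2.1 := Primrec.fst.comp Primrec.snd
  have hf : Primrec (Prod.fst : (α × (List ℕ × List ℕ)) × (List ℕ × List ℕ) → _) := Primrec.fst
  have hff := Primrec.fst.comp hf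
  have hr1 : Primrec fun q : (α × (List ℕ × List ℕ)) × (List ℕ × List ℕ) => q.2.1 :=
    Primrec.fst.comp Primrec.snd
  have hr2 : Primrec fun q : (α × (List ℕ × List ℕ)) × (List ℕ × List ℕ) => q.2.2 :=
    Primrec.snd.comp Primrec.snd
  have h2 : Primrec₂ fun (a : α) (p : List ℕ × List ℕ) =>
      (findChild (c a) (s a) (i a) (ρ a) p.1 p.2).bind fun r =>
        if ρ a ++ [m a] = r.1 then (findChild (c a) (s a) (i a) p.1 r.1 r.2).map some
        else if ρ a ++ [m a] = p.1 then some (some r) else some none := by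
    refine Primrec.option_bind (primrec_findChild (hc.comp Primrec.fst) (hs.comp Primrec.fst)
      (hi.comp Primrec.fst) (hρ.comp Primrec.fst) hp (Primrec.snd.comp Primrec.snd)) ?_
    refine Primrec.ite (Primrec.eq.comp (hch.comp hff) hr1)
      (Primrec.option_map (primrec_findChild (hc.comp hff) (hs.comp hff) (hi.comp hff)
        (hp.comp hf) hr1 hr2) (Primrec.option_some.comp Primrec.snd).to₂) ?_
    exact Primrec.ite (Primrec.eq.comp (hch.comp hff) (hp.comp hf))
      (Primrec.option_some.comp (Primrec.option_some.comp Primrec.snd)) (Primrec.const _)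
  refine (Primrec.option_casesOn ht h1 h2).of_eq fun a => ?_
  cases h : t a <;> rfl

theorem primrec_stateAt {c : α → Code} {s i : α → ℕ} {σ : α → List ℕ} (hc : Primrec c)
    (hs : Primrec s) (hi : Primrec i) (hσ : Primrec σ) :
    Primrec fun a => stateAt (c a) (s a) (i a) (σ a) := by
  refine Primrec.snd.comp (Primrec.list_foldl
    (h := fun a (q : (List ℕ × Option (Option (List ℕ × List ℕ))) × ℕ) => (q.1.1 ++ [q.2],
      q.1.2.bind fun t => stateStep (c a) (s a) (i a) q.1.1 t q.2)) hσ (Primrec.const _) ?_)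
  have h1 : Primrec fun q : α × ((List ℕ × Option (Option (List ℕ × List ℕ))) × ℕ) => q.2.1.1 :=
    Primrec.fst.comp (Primrec.fst.comp Primrec.snd)
  have h2 : Primrec fun q : α × ((List ℕ × Option (Option (List ℕ × List ℕ))) × ℕ) => q.2.1.2 :=
    Primrec.snd.comp (Primrec.fst.comp Primrec.snd)
  have h3 : Primrec fun q : α × ((List ℕ × Option (Option (List ℕ × List ℕ))) × ℕ) => q.2.2 :=
    Primrec.snd.comp Primrec.snd
  have hf : Primrec (Prod.fst : (α × ((List ℕ × Option (Option (List ℕ × List ℕ))) × ℕ)) ×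
    Option (List ℕ × List ℕ) → _) := Primrec.fst
  refine Primrec.pair (Primrec.list_snoc h1 h3) (Primrec.option_bind h2 ?_)
  exact primrec_stateStep (hc.comp (Primrec.fst.comp hf)) (hs.comp (Primrec.fst.comp hf))
    (hi.comp (Primrec.fst.comp hf)) (h1.comp hf) Primrec.snd (h3.comp hf)

theorem primrec_preimageAt {s i : α → ℕ} {p : α → List ℕ} (hs : Primrec s) (hi : Primrec i)
    (hp : Primrec p) : Primrec fun a => preimageAt (s a) (i a) (p a) := by
  refine Primrec.list_findSome? (Primrec.list_range.comp hs) ?_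
  have hy1 : Primrec fun q : α × ℕ => q.2.unpair.1 :=
    Primrec.fst.comp (Primrec.unpair.comp Primrec.snd)
  have hy2 : Primrec fun q : α × ℕ => q.2.unpair.2 :=
    Primrec.snd.comp (Primrec.unpair.comp Primrec.snd)
  exact Primrec.ite (Primrec.eq.comp (primrec_evalString (hi.comp Primrec.fst)
    (Primrec.list_take.comp hy2 (primrec_approxJump.comp (hs.comp Primrec.fst))) hy1)
    (Primrec.option_some.comp (Primrec.encode.comp (hp.comp Primrec.fst))))
    (Primrec.option_some.comp ((Primrec.ofNat (List ℕ)).comp hy1)) (Primrec.const none)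

theorem primrec_stateIncrement {c : α → Code} {s i : α → ℕ} {σ φ : α → List ℕ}
    {t : α → Option (List ℕ × List ℕ)} (hc : Primrec c) (hs : Primrec s) (hi : Primrec i)
    (hσ : Primrec σ) (hφ : Primrec φ) (ht : Primrec t) :
    Primrec fun a => stateIncrement (c a) (s a) (i a) (σ a) (φ a) (t a) := by
  have hd : Primrec₂ fun (a : α) (r : List ℕ × List ℕ) => r.2.drop (φ a).length :=
    Primrec.list_drop.comp (Primrec.list_length.comp (hφ.comp Primrec.fst))
      (Primrec.snd.comp Primrec.snd)
  have h1 : Primrec fun a => (findChild (c a) (s a) (i a) (σ a) [] []).map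
      fun r => [(r.2.drop (φ a).length).headI + 1] :=
    Primrec.option_map (primrec_findChild hc hs hi hσ (Primrec.const []) (Primrec.const []))
      (Primrec.list_cons.comp (Primrec.succ.comp (Primrec.list_headI.comp hd)) (Primrec.const []))
  refine (Primrec.option_casesOn ht h1 (Primrec.option_some.comp hd).to₂).of_eq fun a => ?_
  cases h : t a <;> rfl

theorem primrec_increment {c : α → Code} {s i : α → ℕ} {p φ : α → List ℕ} (hc : Primrec c)
    (hs : Primrec s) (hi : Primrec i) (hp : Primrec p) (hφ : Primrec φ) :
    Primrec fun a => increment (c a) (s a) (i a) (p a) (φ a) := by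
  refine Primrec.option_getD.comp (Primrec.option_bind (primrec_preimageAt hs hi hp) ?_)
    (Primrec.const [])
  refine Primrec.option_bind (primrec_stateAt (hc.comp Primrec.fst) (hs.comp Primrec.fst)
    (hi.comp Primrec.fst) Primrec.snd) ?_
  have hf : Primrec (Prod.fst : (α × List ℕ) × Option (List ℕ × List ℕ) → _) := Primrec.fst
  have hff := Primrec.fst.comp hf
  exact primrec_stateIncrement (hc.comp hff) (hs.comp hff) (hi.comp hff) (Primrec.snd.comp hf)
    (hφ.comp hff) Primrec.snd

theorem primrec_image {c : α → Code} {i : α → ℕ} {p : α → List ℕ} (hc : Primrec c)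
    (hi : Primrec i) (hp : Primrec p) : Primrec fun a => image (c a) (i a) (p a) := by
  refine Primrec.snd.comp (Primrec.list_foldl (h := fun a (q : (List ℕ × List ℕ) × ℕ) =>
    (q.1.1 ++ [q.2], q.1.2 ++ (increment (c a) q.2 (i a) q.1.1 q.1.2 ++ [0]))) hp (Primrec.const _) ?_)
  have h1 : Primrec fun q : α × ((List ℕ × List ℕ) × ℕ) => q.2.1.1 :=
    Primrec.fst.comp (Primrec.fst.comp Primrec.snd)
  have h2 : Primrec fun q : α × ((List ℕ × List ℕ) × ℕ) => q.2.1.2 :=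
    Primrec.snd.comp (Primrec.fst.comp Primrec.snd)
  have h3 : Primrec fun q : α × ((List ℕ × List ℕ) × ℕ) => q.2.2 :=
    Primrec.snd.comp Primrec.snd
  exact Primrec.pair (Primrec.list_snoc h1 h3) (Primrec.list_append.comp h2 (Primrec.list_snoc
    (primrec_increment (hc.comp Primrec.fst) h3 (hi.comp Primrec.fst) h1 h2) (Primrec.const 0)))

end Primrec

/-- A code computing its own associated `image`. -/
theorem exists_code_image : ∃ c : Code, ∀ i p,
    Code.eval c (Nat.pair i (Encodable.encode p)) = Part.some (Encodable.encode (image c i p)) := by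
  -- For an arbitrary code, `image` is total because it runs the code only for boundedly many steps;
  -- so the recursion theorem applies.
  have hf : Computable₂ fun (c : Code) (n : ℕ) =>
      Encodable.encode (image c n.unpair.1 (Denumerable.ofNat (List ℕ) n.unpair.2)) :=
    (Primrec.encode.comp (primrec_image Primrec.fst
      (Primrec.fst.comp (Primrec.unpair.comp Primrec.snd))
      ((Primrec.ofNat (List ℕ)).comp (Primrec.snd.comp (Primrec.unpair.comp Primrec.snd))))).to_comp
  obtain ⟨c, hc⟩ := Code.fixed_point₂ hf.partrec₂
  exact ⟨c, fun i p => by simp [hc]⟩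

/-! ### Limits of the approximations -/

open Filter

theorem zeroJump_approx (k : ℕ) : ∀ᶠ s in atTop, (approxJump s).take k = initSeg zeroJump k := by
  have h : ∀ e, ∀ᶠ s in atTop,
      (cond (Code.evaln s (Denumerable.ofNat Code e) e).isSome 1 0) = zeroJump e := by
    intro e
    by_cases hd : (Code.eval (Denumerable.ofNat Code e) e).Dom
    · obtain ⟨m, hm⟩ := Part.dom_iff_mem.1 hd
      obtain ⟨t, ht⟩ := Code.evaln_complete.1 hm
      filter_upwards [eventually_ge_atTop t] with s hs
      have := Code.evaln_mono hs ht
      rw [Option.mem_def] at this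
      simp [zeroJump, hd, this]
    · refine Eventually.of_forall fun s => ?_
      have : Code.evaln s (Denumerable.ofNat Code e) e = none := by
        rw [Option.eq_none_iff_forall_not_mem]
        exact fun m hm => hd (Part.dom_iff_mem.2 ⟨m, Code.evaln_sound hm⟩)
      simp [zeroJump, hd, this]
  have h' : ∀ᶠ s in atTop, ∀ e ∈ Finset.range k,
      (cond (Code.evaln s (Denumerable.ofNat Code e) e).isSome 1 0) = zeroJump e :=
    (Finset.eventually_all _).2 fun e _ => h e
  filter_upwards [h', eventually_ge_atTop k] with s hs hk
  rw [approxJump, ← List.map_take, List.take_range, min_eq_left hk, initSeg]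
  exact List.map_congr_left fun e he => hs e (by simpa using he)

/-- A bounded search stabilizes if every single test does and some test succeeds in the limit. -/
theorem eventually_findSome? {β : Type*} {g : ℕ → ℕ → Option β} {g' : ℕ → Option β}
    (hg : ∀ z, ∀ᶠ s in atTop, g s z = g' z) (hex : ∃ z, (g' z).isSome) :
    ∃ z b, g' z = some b ∧ ∀ᶠ s in atTop, (List.range s).findSome? (g s) = some b := by
  classical
  obtain ⟨b, hb⟩ := Option.isSome_iff_exists.1 (Nat.find_spec hex)
  refine ⟨Nat.find hex, b, hb, ?_⟩
  -- Only the tests up to the first one that succeeds in the limit matter; they are finitely many,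
  -- so they settle simultaneously.
  have h' : ∀ᶠ s in atTop, ∀ z ∈ Finset.range (Nat.find hex + 1), g s z = g' z :=
    (Finset.eventually_all _).2 fun z _ => hg z
  filter_upwards [h', eventually_gt_atTop (Nat.find hex)] with s hs hlt
  obtain ⟨d, rfl⟩ := Nat.exists_eq_add_of_lt hlt
  have hz : (List.range (Nat.find hex)).findSome? (g (Nat.find hex + d + 1)) = none := by
    rw [List.findSome?_eq_none_iff]
    intro z hz
    rw [List.mem_range] at hz
    rw [hs z (by simp only [Finset.mem_range]; exact hz.trans (Nat.lt_succ_self _))]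
    simpa using Nat.find_min hex hz
  rw [add_assoc, List.range_add, List.findSome?_append, ← add_assoc, hz, List.range_succ_eq_map]
  simp [hs (Nat.find hex) (by simp), hb]

/-! ### Strings and evaluation -/

theorem isInitSegOf_initSeg (X : ℕ → ℕ) (k : ℕ) : IsInitSegOf (initSeg X k) X := by
  simp [IsInitSegOf]

theorem initSeg_prefix (X : ℕ → ℕ) {u k : ℕ} (h : u ≤ k) : initSeg X u <+: initSeg X k :=
  initSeg_take X h ▸ List.take_prefix _ _

theorem IsInitSegOf.of_prefix {σ τ : List ℕ} {X : ℕ → ℕ} (h : IsInitSegOf τ X) (hp : σ <+: τ) :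
    IsInitSegOf σ X := by
  rw [IsInitSegOf, ← initSeg_take X hp.length_le, h]
  exact (List.prefix_iff_eq_take.1 hp).symm

theorem IsInitSegOf.prefix_of_length_le {σ τ : List ℕ} {X : ℕ → ℕ} (hσ : IsInitSegOf σ X)
    (hτ : IsInitSegOf τ X) (h : σ.length ≤ τ.length) : σ <+: τ := by
  rw [← hσ, ← hτ]
  exact initSeg_prefix X h

theorem IsInitSegOf.getElem? {σ : List ℕ} {X : ℕ → ℕ} (h : IsInitSegOf σ X) {n : ℕ}
    (hn : n < σ.length) : σ[n]? = some (X n) := by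
  rw [← h]
  simp [initSeg, hn]

/-- An increasing sequence of strings of unbounded length has a limit. -/
theorem exists_isInitSegOf {l : ℕ → List ℕ} (hl : ∀ n, l n <+: l (n + 1))
    (hlen : ∀ n, n ≤ (l n).length) : ∃ X : ℕ → ℕ, ∀ n, IsInitSegOf (l n) X := by
  have hmono : ∀ {m n}, m ≤ n → l m <+: l n := by
    intro m n h
    induction h with
    | refl => exact List.prefix_rfl
    | step _ ih => exact ih.trans (hl _)
  refine ⟨fun k => (l (k + 1)).getD k 0, fun n => ?_⟩
  refine List.ext_getElem (by simp) fun k h₁ h₂ => ?_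
  have hk : k < (l (k + 1)).length := hlen (k + 1)
  simp only [initSeg, List.getElem_map, List.getElem_range, List.getD_eq_getElem _ _ hk]
  rcases le_total (k + 1) n with h | h
  · exact (hmono h).getElem hk
  · exact ((hmono h).getElem h₂).symm

/-- A candidate `y < j` reads at most `y` oracle values, so its outcome does not change on a longer
segment. The new candidates come later in the search and cannot displace the first success. -/
theorem evalString_initSeg_mono {e : ℕ} {X : ℕ → ℕ} {j k n m : ℕ} (h : j ≤ k)
    (hm : m ∈ evalString e (initSeg X j) n) : m ∈ evalString e (initSeg X k) n := by
  obtain ⟨d, rfl⟩ := Nat.exists_eq_add_of_le h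
  simp only [evalString, initSeg_length, Option.mem_def] at hm ⊢
  rw [List.range_add, List.findSome?_append]
  have : (List.range j).findSome? (fun y => Code.evaln y.unpair.2 (Denumerable.ofNat Code e)
      (Nat.pair (Encodable.encode ((initSeg X (j + d)).take y.unpair.1)) n)) = some m := by
    rw [← hm, ← List.head?_filterMap, ← List.head?_filterMap]
    refine congrArg List.head? (List.filterMap_congr fun y hy => ?_)
    have hy' : y.unpair.1 ≤ j := (Nat.unpair_left_le y).trans (List.mem_range.1 hy).le
    rw [initSeg_take X hy', initSeg_take X (hy'.trans h)]
  rw [this]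
  rfl

theorem mem_functional_iff {e : ℕ} {X : ℕ → ℕ} {n m : ℕ} :
    m ∈ functional e X n ↔ ∃ k, m ∈ evalString e (initSeg X k) n :=
  Nat.rfindOpt_mono fun h hm => evalString_initSeg_mono h hm

/-! ### The image -/

theorem imageAux_fst (c : Code) (i : ℕ) (p : List ℕ) : (imageAux c i p).1 = p := by
  induction p using List.reverseRecOn with
  | nil => rfl
  | append_singleton p x ih =>
    rw [imageAux, List.foldl_append]
    exact congrArg (· ++ [x]) ih

theorem image_append_singleton (c : Code) (i : ℕ) (p : List ℕ) (x : ℕ) :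
    image c i (p ++ [x]) = image c i p ++ (increment c x i p (image c i p) ++ [0]) := by
  have h : image c i (p ++ [x]) = image c i p ++
      (increment c x i (imageAux c i p).1 (image c i p) ++ [0]) := by
    rw [image, imageAux, List.foldl_append]
    rfl
  rw [h, imageAux_fst]

theorem image_prefix (c : Code) (i : ℕ) {p q : List ℕ} (h : p <+: q) :
    image c i p <+: image c i q := by
  obtain ⟨r, rfl⟩ := h
  induction r using List.reverseRecOn with
  | nil => simp
  | append_singleton r x ih =>
    rw [← List.append_assoc, image_append_singleton]
    exact ih.trans (List.prefix_append _ _)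

theorem length_le_length_image (c : Code) (i : ℕ) (p : List ℕ) :
    p.length ≤ (image c i p).length := by
  induction p using List.reverseRecOn with
  | nil => simp
  | append_singleton p x ih =>
    rw [image_append_singleton]
    simp only [List.length_append, List.length_singleton]
    omega

theorem length_image_lt (c : Code) (i : ℕ) {p q : List ℕ} (h : p <+: q)
    (hlt : p.length < q.length) : (image c i p).length < (image c i q).length := by
  obtain ⟨r, rfl⟩ := h
  cases r with
  | nil => simp at hlt
  | cons x r =>
    have h₁ := (image_prefix c i (p := p ++ [x]) (q := p ++ x :: r) ⟨r, by simp⟩).length_le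
    rw [image_append_singleton] at h₁
    simp only [List.length_append, List.length_singleton] at h₁
    omega

theorem stateAux_fst (c : Code) (s i : ℕ) (σ : List ℕ) : (stateAux c s i σ).1 = σ := by
  induction σ using List.reverseRecOn with
  | nil => rfl
  | append_singleton p x ih =>
    rw [stateAux, List.foldl_append]
    exact congrArg (· ++ [x]) ih

theorem stateAt_append_singleton (c : Code) (s i : ℕ) (σ : List ℕ) (m : ℕ) :
    stateAt c s i (σ ++ [m]) = (stateAt c s i σ).bind fun t => stateStep c s i σ t m := by
  have h : stateAt c s i (σ ++ [m]) =
      (stateAt c s i σ).bind fun t => stateStep c s i (stateAux c s i σ).1 t m := by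
    rw [stateAt, stateAux, List.foldl_append]
    rfl
  rw [h, stateAux_fst]

/-! ### f-trees -/

namespace FTree

variable {T : FTree} {σ σ' τ τ' : List ℕ}

/-- The lexicographic order is linear and strictly respected, so `T` is injective. -/
theorem eq_of_mem (h : τ ∈ T.toPFun σ) (h' : τ ∈ T.toPFun σ') : σ = σ' := by
  rcases lt_trichotomy σ σ' with hlt | rfl | hlt
  · exact absurd (T.lex_respecting hlt h h') (lt_irrefl _)
  · rfl
  · exact absurd (T.lex_respecting hlt h' h) (lt_irrefl _)

theorem exists_mem_of_prefix (h : σ <+: σ') (hτ : τ' ∈ T.toPFun σ') :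
    ∃ τ ∈ T.toPFun σ, τ <+: τ' := by
  obtain ⟨τ, hτ'⟩ := Part.dom_iff_mem.1 (T.dom_closed h (Part.dom_iff_mem.2 ⟨_, hτ⟩))
  exact ⟨τ, hτ', T.prefix_respecting h hτ' hτ⟩

theorem child_prefix {m : ℕ} (hτ : τ ∈ T.toPFun σ) (hτ' : τ' ∈ T.toPFun (σ ++ [m])) : τ <+: τ' :=
  T.prefix_respecting (List.prefix_append _ _) hτ hτ'

theorem entry_ne {m₁ m₂ : ℕ} {τ₁ τ₂ : List ℕ} (hne : m₁ ≠ m₂) (hτ : τ ∈ T.toPFun σ)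
    (h₁ : τ₁ ∈ T.toPFun (σ ++ [m₁])) (h₂ : τ₂ ∈ T.toPFun (σ ++ [m₂])) :
    τ₁[τ.length]? ≠ τ₂[τ.length]? := by
  intro heq
  obtain ⟨a₁, ha₁⟩ : ∃ a, τ₁[τ.length]? = some a := ⟨_, List.getElem?_eq_getElem (T.length_lt hτ h₁)⟩
  have ha₂ := heq ▸ ha₁
  rcases lt_or_gt_of_ne hne with h | h
  · exact lt_irrefl _ (T.entry_strictMono h hτ h₁ h₂ ha₁ ha₂)
  · exact lt_irrefl _ (T.entry_strictMono h hτ h₂ h₁ ha₂ ha₁)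

theorem eq_of_isInitSegOf {m₁ m₂ : ℕ} {τ₁ τ₂ : List ℕ} {f : ℕ → ℕ} (hτ : τ ∈ T.toPFun σ)
    (h₁ : τ₁ ∈ T.toPFun (σ ++ [m₁])) (h₂ : τ₂ ∈ T.toPFun (σ ++ [m₂]))
    (hf₁ : IsInitSegOf τ₁ f) (hf₂ : IsInitSegOf τ₂ f) : m₁ = m₂ := by
  by_contra hne
  refine entry_ne hne hτ h₁ h₂ ?_
  rw [hf₁.getElem? (T.length_lt hτ h₁), hf₂.getElem? (T.length_lt hτ h₂)]

/-- A node that lies on a path is one of the nodes that make up the path. -/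
theorem isInitSegOf_of_path {f g : ℕ → ℕ} (hg : ∀ n, ∃ τ ∈ T.toPFun (initSeg g n), IsInitSegOf τ f)
    (hτ : τ ∈ T.toPFun σ) (hf : IsInitSegOf τ f) : IsInitSegOf σ g := by
  induction σ using List.reverseRecOn generalizing τ with
  | nil => simp [IsInitSegOf, initSeg]
  | append_singleton ρ m ih =>
    obtain ⟨τ', hτ', hp⟩ := exists_mem_of_prefix (List.prefix_append ρ [m]) hτ
    have hρ : initSeg g ρ.length = ρ := ih hτ' (hf.of_prefix hp)
    obtain ⟨τ₁, h₁, hf₁⟩ := hg (ρ.length + 1)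
    have hs : initSeg g (ρ.length + 1) = ρ ++ [g ρ.length] := by
      conv_rhs => rw [← hρ]
      simp [initSeg, List.range_succ]
    rw [hs] at h₁
    rw [IsInitSegOf, List.length_append, List.length_singleton, hs,
      eq_of_isInitSegOf hτ' h₁ hτ hf₁ hf]

/-- A path through the node of `σ` has a further node at a child of `σ`, so in a pruned tree no
string of the domain is terminal. -/
theorem infinite_children (hw : T.IsWeaklyOmegaBranching) (hp : T.IsPruned)
    (hσ : (T.toPFun σ).Dom) : {m : ℕ | (T.toPFun (σ ++ [m])).Dom}.Infinite := by
  obtain ⟨τ, hτ⟩ := Part.dom_iff_mem.1 hσ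
  obtain ⟨f, ⟨g, hg⟩, hf⟩ := hp τ ⟨σ, hτ⟩
  have hs : initSeg g σ.length = σ := isInitSegOf_of_path hg hτ hf
  obtain ⟨τ', hτ', -⟩ := hg (σ.length + 1)
  refine hw σ hσ ⟨initSeg g (σ.length + 1), ?_, ?_, Part.dom_iff_mem.2 ⟨τ', hτ'⟩⟩
  · conv_lhs => rw [← hs]
    exact initSeg_prefix g (Nat.le_succ _)
  · intro h
    simpa using congrArg List.length h

/-- Only finitely many children of `σ` have a small entry at the branching position. -/
theorem finite_entry_lt (hτ : τ ∈ T.toPFun σ) (N : ℕ) :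
    {m : ℕ | ∃ τ' ∈ T.toPFun (σ ++ [m]), ∃ a, τ'[τ.length]? = some a ∧ a < N}.Finite := by
  classical
  have h : ∀ m : ℕ, ∃ a : ℕ, ∀ τ' ∈ T.toPFun (σ ++ [m]), τ'[τ.length]? = some a := by
    intro m
    by_cases hd : (T.toPFun (σ ++ [m])).Dom
    · obtain ⟨τ', hτ'⟩ := Part.dom_iff_mem.1 hd
      refine ⟨τ'[τ.length]'(T.length_lt hτ hτ'), fun τ'' h => ?_⟩
      rw [Part.mem_unique h hτ']
      exact List.getElem?_eq_getElem _
    · exact ⟨0, fun τ' h => absurd (Part.dom_iff_mem.2 ⟨τ', h⟩) hd⟩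
  choose a ha using h
  -- The entry at the branching position is injective in the child, and only `N` values lie below
  -- `N`.
  refine Set.Finite.of_injOn (f := a) (t := Set.Iio N) ?_ ?_ (Set.finite_Iio N)
  · rintro m ⟨τ', hτ', b, hb, hlt⟩
    rw [ha m τ' hτ'] at hb
    simpa [Option.some.inj hb] using hlt
  · rintro m₁ ⟨τ₁, h₁, -⟩ m₂ ⟨τ₂, h₂, -⟩ heq
    by_contra hne
    exact entry_ne hne hτ h₁ h₂ (by rw [ha _ _ h₁, ha _ _ h₂, heq])

/-- A sequence of successive children yields a path. -/
theorem exists_path_of_chain {d t : ℕ → List ℕ} (ht : ∀ n, t n ∈ T.toPFun (d n))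
    (hd : ∀ n, ∃ m, d (n + 1) = d n ++ [m]) : ∃ f ∈ T.paths, ∀ n, IsInitSegOf (t n) f := by
  have hlt : ∀ n, (t n).length < (t (n + 1)).length := fun n => by
    obtain ⟨m, hm⟩ := hd n
    exact T.length_lt (ht n) (hm ▸ ht (n + 1))
  have hdp : ∀ n, d n <+: d (n + 1) := fun n => by
    obtain ⟨m, hm⟩ := hd n
    exact hm ▸ List.prefix_append _ _
  have hdl : ∀ n, n ≤ (d n).length := by
    intro n
    induction n with
    | zero => exact Nat.zero_le _
    | succ n ih =>
      obtain ⟨m, hm⟩ := hd n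
      simpa [hm] using ih
  have htl : ∀ n, n ≤ (t n).length := by
    intro n
    induction n with
    | zero => exact Nat.zero_le _
    | succ n ih => exact Nat.succ_le_of_lt (ih.trans_lt (hlt n))
  obtain ⟨g, hg⟩ := exists_isInitSegOf hdp hdl
  obtain ⟨f, hf⟩ := exists_isInitSegOf
    (fun n => T.prefix_respecting (hdp n) (ht n) (ht (n + 1))) htl
  refine ⟨f, ⟨g, fun n => ?_⟩, hf⟩
  have hpre : initSeg g n <+: d n := by
    rw [← hg n]
    exact initSeg_prefix g (hdl n)
  obtain ⟨τ, hτ, hp⟩ := exists_mem_of_prefix hpre (ht n)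
  exact ⟨τ, hτ, (hf n).of_prefix hp⟩

/-- A path has nodes of unbounded length. -/
theorem exists_long_node {f : ℕ → ℕ} (hf : f ∈ T.paths) (n : ℕ) :
    ∃ τ ∈ T.range, IsInitSegOf τ f ∧ n ≤ τ.length := by
  obtain ⟨g, hg⟩ := hf
  induction n with
  | zero =>
    obtain ⟨τ, hτ, hf⟩ := hg 0
    exact ⟨τ, ⟨_, hτ⟩, hf, Nat.zero_le _⟩
  | succ n ih =>
    obtain ⟨τ, ⟨σ, hσ⟩, hτf, hn⟩ := ih
    have hs : initSeg g σ.length = σ := isInitSegOf_of_path hg hσ hτf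
    obtain ⟨τ', hτ', hf'⟩ := hg (σ.length + 1)
    have hs' : initSeg g (σ.length + 1) = σ ++ [g σ.length] := by
      conv_rhs => rw [← hs]
      simp [initSeg, List.range_succ]
    exact ⟨τ', ⟨_, hτ'⟩, hf', Nat.succ_le_of_lt (hn.trans_lt (T.length_lt hσ (hs' ▸ hτ')))⟩

theorem IsComputedBy.exists_evalString {i : ℕ} {X : ℕ → ℕ} (h : T.IsComputedBy i X)
    (hτ : τ ∈ T.toPFun σ) :
    ∃ k, evalString i (initSeg X k) (Encodable.encode σ) = some (Encodable.encode τ) := by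
  have : Encodable.encode τ ∈ functional i X (Encodable.encode σ) := by
    rw [h σ]
    exact Part.mem_map _ hτ
  exact mem_functional_iff.1 this

theorem IsComputedBy.mem_of_evalString {i : ℕ} {X : ℕ → ℕ} (h : T.IsComputedBy i X) {k q : ℕ}
    (hq : evalString i (initSeg X k) (Encodable.encode σ) = some q) :
    ∃ τ ∈ T.toPFun σ, Encodable.encode τ = q := by
  have : q ∈ functional i X (Encodable.encode σ) := mem_functional_iff.2 ⟨k, hq⟩
  rw [h σ] at this
  exact (Part.mem_map_iff _).1 this

end FTree

/-! ### Limits of the states -/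

/-- The code `c` computes its own associated `image`. -/
def ComputesImage (c : Code) : Prop := ∀ i p,
  Code.eval c (Nat.pair i (Encodable.encode p)) = Part.some (Encodable.encode (image c i p))

/-- In the limit, the string `σ` has state `t`. -/
def HasState (c : Code) (i : ℕ) (σ : List ℕ) (t : Option (List ℕ × List ℕ)) : Prop :=
  ∀ᶠ s in atTop, stateAt c s i σ = some t

/-- For a fixed bound `k` on the oracle use, the first `k` values of the approximation settle, and
the run of `c` on the resulting code halts. -/
theorem eventually_imageAt {c : Code} (hc : ComputesImage c) (i k : ℕ) (σ : List ℕ) :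
    ∀ᶠ s in atTop, imageAt c s i k σ =
      (evalString i (initSeg zeroJump k) (Encodable.encode σ)).map fun q =>
        image c i (Denumerable.ofNat (List ℕ) q) := by
  cases hq : evalString i (initSeg zeroJump k) (Encodable.encode σ) with
  | none =>
    filter_upwards [zeroJump_approx k] with s hs
    simp [imageAt, hs, hq]
  | some q =>
    have h := hc i (Denumerable.ofNat (List ℕ) q)
    rw [Denumerable.encode_ofNat] at h
    obtain ⟨t, ht⟩ := Code.evaln_complete.1 (Part.eq_some_iff.1 h)
    filter_upwards [zeroJump_approx k, eventually_ge_atTop t] with s hs hts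
    have h' := Code.evaln_mono hts ht
    rw [Option.mem_def] at h'
    simp [imageAt, hs, hq, h']

section Tree

variable {c : Code} (hc : ComputesImage c) {i : ℕ} {T : FTree} (hT : T.IsComputedBy i zeroJump)

include hc hT

/-- The search runs over pairs of a child and a use bound, each tested in a way that stabilizes. The
hypothesis only guarantees some success; the child found may be a different one. -/
theorem findChild_limit {σ excl req : List ℕ}
    (hex : ∃ m, ∃ τ ∈ T.toPFun (σ ++ [m]), σ ++ [m] ≠ excl ∧ req <+: image c i τ) :
    ∃ m, ∃ τ ∈ T.toPFun (σ ++ [m]), σ ++ [m] ≠ excl ∧ req <+: image c i τ ∧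
      ∀ᶠ s in atTop, findChild c s i σ excl req = some (σ ++ [m], image c i τ) := by
  obtain ⟨z, b, hz, hs⟩ := eventually_findSome?
    (g := fun s z => (imageAt c s i z.unpair.2 (σ ++ [z.unpair.1])).bind fun w =>
      if σ ++ [z.unpair.1] ≠ excl ∧ w.take req.length = req then
        some (σ ++ [z.unpair.1], w) else none)
    (g' := fun z => ((evalString i (initSeg zeroJump z.unpair.2)
        (Encodable.encode (σ ++ [z.unpair.1]))).map fun q =>
          image c i (Denumerable.ofNat (List ℕ) q)).bind fun w =>
      if σ ++ [z.unpair.1] ≠ excl ∧ w.take req.length = req then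
        some (σ ++ [z.unpair.1], w) else none)
    (fun z => by
      filter_upwards [eventually_imageAt hc i z.unpair.2 (σ ++ [z.unpair.1])] with s hs
      rw [hs])
    (by
      obtain ⟨m, τ, hτ, hne, hreq⟩ := hex
      obtain ⟨k, hk⟩ := hT.exists_evalString hτ
      refine ⟨Nat.pair m k, ?_⟩
      simp only [Nat.unpair_pair, hk, Option.map_some, Denumerable.ofNat_encode, Option.bind_some]
      rw [if_pos ⟨hne, (List.prefix_iff_eq_take.1 hreq).symm⟩]
      rfl)
  obtain ⟨w, hw, hb⟩ := Option.bind_eq_some_iff.1 hz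
  obtain ⟨q, hq, rfl⟩ := Option.map_eq_some_iff.1 hw
  obtain ⟨τ, hτ, rfl⟩ := hT.mem_of_evalString hq
  rw [Denumerable.ofNat_encode] at hb
  split_ifs at hb with hcond
  obtain rfl := Option.some.inj hb
  exact ⟨_, τ, hτ, hcond.1, List.prefix_iff_eq_take.2 hcond.2.symm, hs⟩

-- Whichever test succeeds first in the limit, injectivity of `T` forces its string to be `σ`.
omit hc in
theorem preimageAt_limit {σ τ : List ℕ} (hτ : τ ∈ T.toPFun σ) :
    ∀ᶠ s in atTop, preimageAt s i τ = some σ := by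
  obtain ⟨z, b, hz, hs⟩ := eventually_findSome?
    (g := fun s z => if evalString i ((approxJump s).take z.unpair.2) z.unpair.1 =
      some (Encodable.encode τ) then some (Denumerable.ofNat (List ℕ) z.unpair.1) else none)
    (g' := fun z => if evalString i (initSeg zeroJump z.unpair.2) z.unpair.1 =
      some (Encodable.encode τ) then some (Denumerable.ofNat (List ℕ) z.unpair.1) else none)
    (fun z => by
      filter_upwards [zeroJump_approx z.unpair.2] with s hs
      rw [hs])
    (by
      obtain ⟨k, hk⟩ := hT.exists_evalString hτ
      refine ⟨Nat.pair (Encodable.encode σ) k, ?_⟩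
      simp only [Nat.unpair_pair, hk, if_true]
      rfl)
  split_ifs at hz with hcond
  obtain rfl := Option.some.inj hz
  rw [← Denumerable.encode_ofNat (α := List ℕ) z.unpair.1] at hcond
  obtain ⟨τ', hτ', he⟩ := hT.mem_of_evalString hcond
  rw [Encodable.encode_injective he] at hτ'
  rw [FTree.eq_of_mem hτ hτ']
  exact hs

omit hc in
/-- All but finitely many children of a node extend its image by the limit increment. -/
theorem finite_not_extending {σ τ u : List ℕ} {t : Option (List ℕ × List ℕ)}
    (hτ : τ ∈ T.toPFun σ) (ht : HasState c i σ t)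
    (hu : ∀ᶠ s in atTop, stateIncrement c s i σ (image c i τ) t = some u) :
    {m : ℕ | ∃ τ' ∈ T.toPFun (σ ++ [m]), ¬ image c i τ ++ u <+: image c i τ'}.Finite := by
  have hinc : ∀ᶠ x in atTop, increment c x i τ (image c i τ) = u := by
    filter_upwards [preimageAt_limit hT hτ, ht, hu] with x h₁ h₂ h₃
    simp [increment, h₁, h₂, h₃]
  obtain ⟨N, hN⟩ := eventually_atTop.1 hinc
  -- A child whose branching entry is at least `N` uses a stage at which the increment has settled,
  -- so only those with smaller entries can fail.
  refine (FTree.finite_entry_lt hτ N).subset ?_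
  rintro m ⟨τ', hτ', hnot⟩
  have hlen := T.length_lt hτ hτ'
  refine ⟨τ', hτ', τ'[τ.length], List.getElem?_eq_getElem hlen, ?_⟩
  by_contra hge
  refine hnot ?_
  have hpre : τ ++ [τ'[τ.length]] <+: τ' := by
    obtain ⟨r, rfl⟩ := FTree.child_prefix hτ hτ'
    cases r with
    | nil => simp at hlen
    | cons a r => exact ⟨r, by simp⟩
  refine List.IsPrefix.trans ?_ (image_prefix c i hpre)
  rw [image_append_singleton, hN _ (not_lt.1 hge), ← List.append_assoc]
  exact List.prefix_append _ _

variable (hinf : ∀ σ, (T.toPFun σ).Dom → {m : ℕ | (T.toPFun (σ ++ [m])).Dom}.Infinite)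

omit hc hT in
include hinf in
theorem exists_child_notMem {σ : List ℕ} (hσ : (T.toPFun σ).Dom) {s : Set ℕ} (hs : s.Finite) :
    ∃ m, m ∉ s ∧ ∃ τ, τ ∈ T.toPFun (σ ++ [m]) := by
  obtain ⟨m, hm, hms⟩ := ((hinf σ hσ).sdiff hs).nonempty
  exact ⟨m, hms, Part.dom_iff_mem.1 hm⟩

omit hc hT in
theorem finite_child_eq (σ π : List ℕ) : {m : ℕ | σ ++ [m] = π}.Finite :=
  Set.Subsingleton.finite fun m₁ h₁ m₂ h₂ => by
    have h : σ ++ [m₁] = σ ++ [m₂] := h₁.trans h₂.symm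
    simpa using h

omit hc hT in
/-- In the limit, `π` is the partner of `σ`, and the images of `σ` and `π` are compatible. -/
def IsPartner (c : Code) (i : ℕ) (T : FTree) (σ π : List ℕ) : Prop :=
  ∃ τ ∈ T.toPFun σ, ∃ τ' ∈ T.toPFun π, image c i τ <+: image c i τ' ∧
    HasState c i σ (some (π, image c i τ'))

/-- The string `σ` has partner `π`, which is a child either of `σ` or of the string with
partner `σ` from which it was found. -/
def IsLinked (c : Code) (i : ℕ) (T : FTree) (σ π : List ℕ) : Prop :=
  IsPartner c i T σ π ∧ ((∃ m, π = σ ++ [m]) ∨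
    ∃ ρ m, ∃ τ ∈ T.toPFun σ, ∃ τ' ∈ T.toPFun π, π = ρ ++ [m] ∧
      HasState c i ρ (some (σ, image c i τ)) ∧
      ∀ᶠ s in atTop, findChild c s i ρ σ (image c i τ) = some (π, image c i τ'))

include hinf

/-- The increment of `σ` is exactly what its image lacks of the partner's. So cofinitely many
children qualify, even after excluding `π`, which may be one of them. -/
theorem IsPartner.exists_findChild {σ π : List ℕ} (h : IsPartner c i T σ π) :
    ∃ m, ∃ τ ∈ T.toPFun (σ ++ [m]), ∃ τ' ∈ T.toPFun π, σ ++ [m] ≠ π ∧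
      image c i τ' <+: image c i τ ∧
      HasState c i σ (some (π, image c i τ')) ∧
      ∀ᶠ s in atTop, findChild c s i σ π (image c i τ') = some (σ ++ [m], image c i τ) := by
  obtain ⟨τ, hτ, τ', hτ', hpre, hst⟩ := h
  obtain ⟨u, hu⟩ := hpre
  have hfin := finite_not_extending (u := u) hT hτ hst
    (Eventually.of_forall fun s => by simp [stateIncrement, ← hu])
  obtain ⟨m, hm, τ₁, hτ₁⟩ := exists_child_notMem hinf (Part.dom_iff_mem.2 ⟨τ, hτ⟩)
    (hfin.union (finite_child_eq σ π))
  simp only [Set.mem_union, Set.mem_ofPred_eq, not_or, not_exists, not_and, not_not] at hm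
  have h₁ := hm.1 τ₁ hτ₁
  rw [hu] at h₁
  obtain ⟨m', τ₂, hτ₂, hne, hpre', hlim⟩ := findChild_limit hc hT ⟨m, τ₁, hτ₁, hm.2, h₁⟩
  exact ⟨m', τ₂, hτ₂, τ', hτ', hne, hpre', hst, hlim⟩

/-- The point is that `π` settles on precisely the child that `σ` finds. If `π` is a child of `σ`,
its state is the result of that same search. Otherwise `π` was itself found from a string with
partner `σ`, and its state was defined by repeating the search below `σ` with the same arguments. -/
theorem IsLinked.advance {σ π : List ℕ} (h : IsLinked c i T σ π) :
    ∃ m, ∃ τ ∈ T.toPFun (σ ++ [m]), ∃ τ' ∈ T.toPFun π, σ ++ [m] ≠ π ∧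
      IsLinked c i T π (σ ++ [m]) ∧ HasState c i σ (some (π, image c i τ')) ∧
      ∀ᶠ s in atTop, findChild c s i σ π (image c i τ') = some (σ ++ [m], image c i τ) := by
  obtain ⟨m, τ, hτ, τ', hτ', hne, hpre, hst, hlim⟩ := h.1.exists_findChild hc hT hinf
  refine ⟨m, τ, hτ, τ', hτ', hne, ⟨⟨τ', hτ', τ, hτ, hpre, ?_⟩,
    Or.inr ⟨σ, m, τ', hτ', τ, hτ, rfl, hst, hlim⟩⟩, hst, hlim⟩
  rcases h.2 with ⟨m', rfl⟩ | ⟨ρ, m', τσ, hτσ, τπ, hτπ, rfl, hρ, hlimρ⟩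
  · filter_upwards [hst, hlim] with s h₁ h₂
    simp only [stateAt_append_singleton, h₁, Option.bind_some, stateStep, h₂]
    rw [if_neg (Ne.symm hne), if_pos trivial]
  · rw [Part.mem_unique hτπ hτ'] at hlimρ
    filter_upwards [hρ, hlimρ, hlim] with s h₁ h₂ h₃
    simp only [stateAt_append_singleton, h₁, Option.bind_some, stateStep, h₂, if_true, h₃,
      Option.map_some]

/-- The child takes a child of its own as its partner; monotonicity of the image makes the two
images compatible. -/
theorem HasState.child_isLinked {σ : List ℕ} (h : HasState c i σ none) {m : ℕ}
    (hm : (T.toPFun (σ ++ [m])).Dom) : ∃ π, IsLinked c i T (σ ++ [m]) π ∧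
      ∃ m', π = σ ++ [m] ++ [m'] := by
  obtain ⟨m₁, -, τ₁, hτ₁⟩ := exists_child_notMem hinf hm Set.finite_empty
  obtain ⟨m', τ', hτ', -, -, hlim⟩ := findChild_limit (excl := []) (req := []) hc hT
    ⟨m₁, τ₁, hτ₁, by simp, List.nil_prefix⟩
  obtain ⟨τ, hτ⟩ := Part.dom_iff_mem.1 hm
  refine ⟨_, ⟨⟨τ, hτ, τ', hτ', image_prefix c i (FTree.child_prefix hτ hτ'), ?_⟩,
    Or.inl ⟨m', rfl⟩⟩, m', rfl⟩
  filter_upwards [h, hlim] with s h₁ h₂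
  simp [stateAt_append_singleton, h₁, stateStep, h₂]

theorem hasState_none_or_isLinked {σ : List ℕ} (hσ : (T.toPFun σ).Dom) :
    HasState c i σ none ∨ ∃ π, IsLinked c i T σ π := by
  induction σ using List.reverseRecOn with
  | nil => exact Or.inl (Eventually.of_forall fun s => rfl)
  | append_singleton ρ m ih =>
    rcases ih (T.dom_closed (List.prefix_append _ _) hσ) with h | ⟨π, h⟩
    · obtain ⟨π, hπ, -⟩ := h.child_isLinked hc hT hinf hσ
      exact Or.inr ⟨π, hπ⟩
    · obtain ⟨m', τ, hτ, τ', hτ', hne, hl, hst, hlim⟩ := h.advance hc hT hinf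
      by_cases h₁ : ρ ++ [m] = ρ ++ [m']
      -- After one advance the chosen child is still the partner of `π`; a second advance gives it a
      -- partner of its own.
      · obtain ⟨m'', _, _, _, _, _, hl', _⟩ := hl.advance hc hT hinf
        exact Or.inr ⟨_, h₁ ▸ hl'⟩
      · by_cases h₂ : ρ ++ [m] = π
        · exact Or.inr ⟨_, h₂ ▸ hl⟩
        · left
          filter_upwards [hst, hlim] with s h₃ h₄
          simp only [stateAt_append_singleton, h₃, Option.bind_some, stateStep, h₄, if_neg h₁,
            if_neg h₂]

/-- A linked string passes its task on to at most two children, the chosen one and possibly its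
partner; any other child has state `none`. -/
theorem exists_hasState_none {σ : List ℕ} (hσ : (T.toPFun σ).Dom) :
    ∃ σ', σ <+: σ' ∧ (T.toPFun σ').Dom ∧ HasState c i σ' none := by
  rcases hasState_none_or_isLinked hc hT hinf hσ with h | ⟨π, h⟩
  · exact ⟨σ, List.prefix_rfl, hσ, h⟩
  · obtain ⟨m', τ, hτ, τ', hτ', hne, hl, hst, hlim⟩ := h.advance hc hT hinf
    obtain ⟨m, hm, τ₁, hτ₁⟩ := exists_child_notMem hinf hσ
      ((finite_child_eq σ (σ ++ [m'])).union (finite_child_eq σ π))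
    simp only [Set.mem_union, Set.mem_ofPred_eq, not_or] at hm
    refine ⟨σ ++ [m], List.prefix_append _ _, Part.dom_iff_mem.2 ⟨_, hτ₁⟩, ?_⟩
    filter_upwards [hst, hlim] with s h₃ h₄
    simp only [stateAt_append_singleton, h₃, Option.bind_some, stateStep, h₄, if_neg hm.1,
      if_neg hm.2]

theorem exists_incompatible_images {σ τ : List ℕ} (hτ : τ ∈ T.toPFun σ)
    (h : HasState c i σ none) : ∃ τ₀ ∈ T.range, ∃ τ₁ ∈ T.range, τ <+: τ₀ ∧ τ <+: τ₁ ∧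
      Incompatible (image c i τ₀) (image c i τ₁) := by
  have hσ : (T.toPFun σ).Dom := Part.dom_iff_mem.2 ⟨τ, hτ⟩
  obtain ⟨m, -, τ', hτ'⟩ := exists_child_notMem hinf hσ Set.finite_empty
  obtain ⟨m₀, τ₀, hτ₀, -, -, hlim⟩ := findChild_limit (excl := []) (req := []) hc hT
    ⟨m, τ', hτ', by simp, List.nil_prefix⟩
  have hp₀ := FTree.child_prefix hτ hτ₀
  obtain ⟨u, hu⟩ := image_prefix c i hp₀
  have hlt := length_image_lt c i hp₀ (T.length_lt hτ hτ₀)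
  obtain ⟨v, w, rfl⟩ : ∃ v w, u = v :: w := by
    cases u with
    | nil => simp [← hu] at hlt
    | cons v w => exact ⟨v, w, rfl⟩
  have hfin := finite_not_extending (u := [v + 1]) hT hτ h (by
    filter_upwards [hlim] with s hs
    simp [stateIncrement, hs, ← hu])
  obtain ⟨m₁, hm₁, τ₁, hτ₁⟩ := exists_child_notMem hinf hσ hfin
  simp only [Set.mem_ofPred_eq, not_exists, not_and, not_not] at hm₁
  obtain ⟨w', hw'⟩ := hm₁ τ₁ hτ₁
  refine ⟨τ₀, ⟨_, hτ₀⟩, τ₁, ⟨_, hτ₁⟩, hp₀, FTree.child_prefix hτ hτ₁, ?_⟩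
  rw [← hu, ← hw', List.append_assoc]
  constructor <;> intro hpre <;> rw [List.prefix_append_right_inj] at hpre <;>
    simp [List.cons_prefix_cons] at hpre

/-- Above a node whose string has state `none` there are two paths along which the images agree. -/
theorem exists_paths_image_agree {σ τ : List ℕ} (hτ : τ ∈ T.toPFun σ)
    (h : HasState c i σ none) : ∃ f ∈ T.paths, ∃ g ∈ T.paths,
      IsInitSegOf τ f ∧ IsInitSegOf τ g ∧ f ≠ g ∧
      ∀ k, ∃ p q, k ≤ p.length ∧ IsInitSegOf p g ∧ IsInitSegOf q f ∧
        image c i p <+: image c i q := by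
  have hσ : (T.toPFun σ).Dom := Part.dom_iff_mem.2 ⟨τ, hτ⟩
  obtain ⟨m, -, hm⟩ := exists_child_notMem hinf hσ Set.finite_empty
  obtain ⟨π, hπ, m', hm'⟩ := h.child_isLinked hc hT hinf (Part.dom_iff_mem.2 hm)
  -- The leapfrog step sends `(a, b)` to `(b, a ++ [m])`. Iterating it gives one sequence `d` in
  -- which `d (n + 2)` is a child of `d n` and the images increase with `n`; its even and odd terms
  -- form the two paths.
  have hadv : ∀ p : {p : List ℕ × List ℕ // IsLinked c i T p.1 p.2},
      ∃ q : {p : List ℕ × List ℕ // IsLinked c i T p.1 p.2},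
        q.1.1 = p.1.2 ∧ (∃ m, q.1.2 = p.1.1 ++ [m]) ∧ q.1.2 ≠ p.1.2 := by
    rintro ⟨⟨a, b⟩, hab⟩
    obtain ⟨m, _, _, _, _, hne, hl, _⟩ := hab.advance hc hT hinf
    exact ⟨⟨(b, a ++ [m]), hl⟩, rfl, ⟨m, rfl⟩, hne⟩
  choose nxt hnxt₁ hnxt₂ hnxt₃ using hadv
  let P : ℕ → {p : List ℕ × List ℕ // IsLinked c i T p.1 p.2} :=
    fun n => Nat.rec ⟨(σ ++ [m], π), hπ⟩ (fun _ p => nxt p) n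
  let d : ℕ → List ℕ := fun n => (P n).1.1
  have hd1 : ∀ n, (P n).1.2 = d (n + 1) := fun n => (hnxt₁ (P n)).symm
  have hd2 : ∀ n, ∃ m, d (n + 2) = d n ++ [m] := fun n => by
    obtain ⟨m, hm⟩ := hnxt₂ (P n)
    exact ⟨m, (hd1 (n + 1)).symm.trans hm⟩
  have hd3 : ∀ n, d (n + 2) ≠ d (n + 1) := fun n => by
    rw [← hd1 (n + 1), ← hd1 n]
    exact hnxt₃ (P n)
  have hdz : d 1 = d 0 ++ [m'] := (hd1 0).symm.trans hm'
  have hex : ∀ n, ∃ t ∈ T.toPFun (d n), ∀ t' ∈ T.toPFun (d (n + 1)),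
      image c i t <+: image c i t' := fun n => by
    obtain ⟨t, ht, t', ht', hpre, -⟩ := (P n).2.1
    rw [hd1 n] at ht'
    exact ⟨t, ht, fun t'' h => Part.mem_unique h ht' ▸ hpre⟩
  choose t ht himg using hex
  have himg' : ∀ n, image c i (t n) <+: image c i (t (n + 1)) := fun n => himg n _ (ht (n + 1))
  obtain ⟨f, hf, hff⟩ := FTree.exists_path_of_chain (T := T) (d := fun n => d (2 * n))
    (t := fun n => t (2 * n)) (fun n => ht (2 * n)) (fun n => hd2 (2 * n))
  obtain ⟨g, hg, hgg⟩ := FTree.exists_path_of_chain (T := T) (d := fun n => d (2 * n + 1))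
    (t := fun n => t (2 * n + 1)) (fun n => ht (2 * n + 1)) (fun n => hd2 (2 * n + 1))
  have hτ0 : τ <+: t 0 := T.prefix_respecting (List.prefix_append σ [m]) hτ (ht 0)
  have h01 : t 0 <+: t 1 := FTree.child_prefix (ht 0) (hdz ▸ ht 1)
  refine ⟨f, hf, g, hg, (hff 0).of_prefix hτ0, (hgg 0).of_prefix (hτ0.trans h01), ?_, fun k => ?_⟩
  · rintro rfl
    -- The strings `d 1` and `d 2` are distinct children of `d 0`, one on each path, so the paths
    -- separate there.
    obtain ⟨m'', hm''⟩ := hd2 0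
    have := FTree.eq_of_isInitSegOf (ht 0) (hm'' ▸ ht 2) (hdz ▸ ht 1) (hff 1) (hgg 0)
    exact hd3 0 (hm''.trans (this ▸ hdz.symm))
  · have hlen : k ≤ (t (2 * k + 1)).length := by
      induction k with
      | zero => exact Nat.zero_le _
      | succ k ih =>
        obtain ⟨m, hm⟩ := hd2 (2 * k + 1)
        have := T.length_lt (ht (2 * k + 1)) (hm ▸ ht (2 * k + 1 + 2))
        rw [show 2 * (k + 1) + 1 = 2 * k + 1 + 2 by ring]
        omega
    exact ⟨t (2 * k + 1), t (2 * (k + 1)), hlen, hgg k, hff (k + 1), himg' (2 * k + 1)⟩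

end Tree

/-! ### The index of the functional -/

/-- There are indices, uniform in `i`, of functionals that output the image of the oracle. -/
theorem exists_index_image (c : Code) : ∃ h : ℕ → ℕ, Computable h ∧ ∀ i ρ n,
    Code.eval (Denumerable.ofNat Code (h i)) (Nat.pair (Encodable.encode ρ) n) =
      ((image c i ρ)[n]? : Part ℕ) := by
  have hF : Computable fun x : ℕ => (image c x.unpair.1
      (Denumerable.ofNat (List ℕ) x.unpair.2.unpair.1))[x.unpair.2.unpair.2]? := by
    have h₁ : Primrec fun x : ℕ => x.unpair.1 := Primrec.fst.comp Primrec.unpair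
    have h₂ : Primrec fun x : ℕ => x.unpair.2 := Primrec.snd.comp Primrec.unpair
    exact (Primrec.list_getElem?.comp (primrec_image (Primrec.const c) h₁
      ((Primrec.ofNat (List ℕ)).comp (h₁.comp h₂))) (h₂.comp h₂)).to_comp
  obtain ⟨d, hd⟩ := Code.exists_code.1 (Partrec.nat_iff.1 hF.ofOption)
  refine ⟨fun i => Encodable.encode (Code.curry d i), (Primrec.encode.comp
    (Code.primrec₂_curry.comp (Primrec.const d) Primrec.id)).to_comp, fun i ρ n => ?_⟩
  rw [Denumerable.ofNat_encode, Code.eval_curry, hd]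
  simp

section Index

variable {c : Code} {e i : ℕ} (he : ∀ ρ n,
  Code.eval (Denumerable.ofNat Code e) (Nat.pair (Encodable.encode ρ) n) =
    ((image c i ρ)[n]? : Part ℕ))

theorem exists_image_limit (c : Code) (i : ℕ) (f : ℕ → ℕ) :
    ∃ Y : ℕ → ℕ, ∀ p, IsInitSegOf p f → IsInitSegOf (image c i p) Y := by
  obtain ⟨Y, hY⟩ := exists_isInitSegOf (l := fun k => image c i (initSeg f k))
    (fun n => image_prefix c i (initSeg_prefix f (Nat.le_succ n)))
    (fun n => by simpa using length_le_length_image c i (initSeg f n))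
  exact ⟨Y, fun p hp => hp ▸ hY p.length⟩

include he

/-- Every output is read off the image of some initial segment of `f`, hence from `Y`. The segment
of length `n + 1` already has an image long enough to give an output, and the bound on `k` brings
that halting computation within the search. -/
theorem eventually_evalString {f Y : ℕ → ℕ} (hY : ∀ p, IsInitSegOf p f → IsInitSegOf (image c i p) Y)
    (n : ℕ) : ∀ᶠ k in atTop, evalString e (initSeg f k) n = some (Y n) := by
  have hval : ∀ k m, m ∈ evalString e (initSeg f k) n → m = Y n := by
    intro k m hm
    obtain ⟨u, hu⟩ := evalString_initSeg_isSome hm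
    rw [he, Part.mem_ofOption, Option.mem_def] at hu
    obtain ⟨hlt, -⟩ := List.getElem?_eq_some_iff.1 hu
    rw [(hY _ (isInitSegOf_initSeg f u)).getElem? hlt] at hu
    exact (Option.some.inj hu).symm
  have hmem : Y n ∈ Code.eval (Denumerable.ofNat Code e)
      (Nat.pair (Encodable.encode (initSeg f (n + 1))) n) := by
    rw [he, Part.mem_ofOption, Option.mem_def]
    refine (hY _ (isInitSegOf_initSeg f _)).getElem? ?_
    have := length_le_length_image c i (initSeg f (n + 1))
    rw [initSeg_length] at this
    exact this
  obtain ⟨t, ht⟩ := Code.evaln_complete.1 hmem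
  filter_upwards [eventually_gt_atTop (Nat.pair (n + 1) t)] with k hk
  have hsome : (evalString e (initSeg f k) n).isSome := by
    rw [evalString, List.findSome?_isSome_iff]
    refine ⟨Nat.pair (n + 1) t, by simpa using hk, ?_⟩
    rw [Nat.unpair_pair, initSeg_take f ((Nat.left_le_pair _ _).trans hk.le)]
    exact Option.isSome_iff_exists.2 ⟨_, ht⟩
  obtain ⟨m, hm⟩ := Option.isSome_iff_exists.1 hsome
  rw [hm, hval k m hm]

theorem mem_functional_of_image {f Y : ℕ → ℕ}
    (hY : ∀ p, IsInitSegOf p f → IsInitSegOf (image c i p) Y) (n : ℕ) : Y n ∈ functional e f n :=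
  mem_functional_iff.2 (eventually_evalString he hY n).exists

theorem eventually_prefix_functionalString {f Y : ℕ → ℕ}
    (hY : ∀ p, IsInitSegOf p f → IsInitSegOf (image c i p) Y) (N : ℕ) :
    ∀ᶠ k in atTop, initSeg Y N <+: functionalString e (initSeg f k) := by
  have h : ∀ᶠ k in atTop, ∀ n ∈ Finset.range N, evalString e (initSeg f k) n = some (Y n) :=
    (Finset.eventually_all _).2 fun n _ => eventually_evalString he hY n
  filter_upwards [h, eventually_ge_atTop N] with k hk hN
  obtain ⟨d, rfl⟩ := Nat.exists_eq_add_of_le hN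
  have hmap : (List.range N).map (evalString e (initSeg f (N + d))) = (initSeg Y N).map some := by
    rw [show initSeg Y N = (List.range N).map Y from rfl, List.map_map]
    exact List.map_congr_left fun n hn => hk n (by simpa using hn)
  have hred : ((initSeg Y N).map some).reduceOption = initSeg Y N := by
    simp [List.reduceOption, List.filterMap_map]
  rw [functionalString, initSeg_length, List.range_add, List.map_append, hmap,
    List.takeWhile_append_of_pos (by simp), List.reduceOption_append, hred]
  exact List.prefix_append _ _

end Index

theorem mainTheorem8 :
    ∃ h : ℕ → ℕ, Computable h ∧
      ∀ (i : ℕ) (T : FTree), T.IsComputedBy i zeroJump → T.IsPerfect →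
        T.IsWeaklyOmegaBranching → T.IsPruned →
        (∀ τ ∈ T.range, ∃ τ₀ ∈ T.range, ∃ τ₁ ∈ T.range,
          τ <+: τ₀ ∧ τ <+: τ₁ ∧ ESplit (h i) τ₀ τ₁) ∧
        (∀ τ ∈ T.range, ∃ f ∈ T.paths, ∃ g ∈ T.paths,
          IsInitSegOf τ f ∧ IsInitSegOf τ g ∧ f ≠ g ∧
          ∃ Y : ℕ → ℕ, ∀ n, Y n ∈ functional (h i) f n ∧ Y n ∈ functional (h i) g n) := by
  obtain ⟨c, hc⟩ := exists_code_image
  obtain ⟨h, hh, he⟩ := exists_index_image c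
  refine ⟨h, hh, fun i T hT _ hw hp => ?_⟩
  have hinf : ∀ σ, (T.toPFun σ).Dom → {m : ℕ | (T.toPFun (σ ++ [m])).Dom}.Infinite :=
    fun σ hσ => FTree.infinite_children hw hp hσ
  constructor
  · rintro τ ⟨σ, hτ⟩
    obtain ⟨σ', hσ', hd, hst⟩ := exists_hasState_none hc hT hinf (Part.dom_iff_mem.2 ⟨τ, hτ⟩)
    obtain ⟨τ', hτ'⟩ := Part.dom_iff_mem.1 hd
    obtain ⟨τ₀, h₀, τ₁, h₁, hp₀, hp₁, hinc⟩ := exists_incompatible_images hc hT hinf hτ' hst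
    -- The bounded evaluation on a node may lag behind its image. Following a path through the node
    -- far enough, to a longer node, recovers the whole image.
    have key : ∀ ρ ∈ T.range, ∃ ρ' ∈ T.range, ρ <+: ρ' ∧
        image c i ρ <+: functionalString (h i) ρ' := by
      intro ρ hρ
      obtain ⟨f, hf, hρf⟩ := hp ρ hρ
      obtain ⟨Y, hY⟩ := exists_image_limit c i f
      obtain ⟨K, hK⟩ := eventually_atTop.1
        (eventually_prefix_functionalString (he i) hY (image c i ρ).length)
      obtain ⟨ρ', hρ', hρ'f, hlen⟩ := FTree.exists_long_node hf (max K ρ.length)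
      refine ⟨ρ', hρ', hρf.prefix_of_length_le hρ'f ((le_max_right _ _).trans hlen), ?_⟩
      have := hK ρ'.length ((le_max_left _ _).trans hlen)
      rwa [hY ρ hρf, hρ'f] at this
    obtain ⟨ρ₀, hρ₀, hpρ₀, hi₀⟩ := key τ₀ h₀
    obtain ⟨ρ₁, hρ₁, hpρ₁, hi₁⟩ := key τ₁ h₁
    have hpre := T.prefix_respecting hσ' hτ hτ'
    refine ⟨ρ₀, hρ₀, ρ₁, hρ₁, (hpre.trans hp₀).trans hpρ₀, (hpre.trans hp₁).trans hpρ₁, ?_, ?_⟩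
    · exact fun hle => (List.prefix_or_prefix_of_prefix (hi₀.trans hle) hi₁).elim hinc.1 hinc.2
    · exact fun hle => (List.prefix_or_prefix_of_prefix hi₀ (hi₁.trans hle)).elim hinc.1 hinc.2
  · rintro τ ⟨σ, hτ⟩
    obtain ⟨σ', hσ', hd, hst⟩ := exists_hasState_none hc hT hinf (Part.dom_iff_mem.2 ⟨τ, hτ⟩)
    obtain ⟨τ', hτ'⟩ := Part.dom_iff_mem.1 hd
    obtain ⟨f, hf, g, hg, hτf, hτg, hne, hagree⟩ := exists_paths_image_agree hc hT hinf hτ' hst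
    have hpre := T.prefix_respecting hσ' hτ hτ'
    obtain ⟨Y, hY⟩ := exists_image_limit c i f
    obtain ⟨Z, hZ⟩ := exists_image_limit c i g
    refine ⟨f, hf, g, hg, hτf.of_prefix hpre, hτg.of_prefix hpre, hne, Y, fun n =>
      ⟨mem_functional_of_image (he i) hY n, ?_⟩⟩
    -- A segment of length at least `n + 1` has an image with an entry at `n`; this image lies along
    -- both limits, so `Y n = Z n`.
    obtain ⟨p, q, hlen, hpg, hqf, hpq⟩ := hagree (n + 1)
    have hlt : n < (image c i p).length := hlen.trans (length_le_length_image c i p)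
    have h₁ := (hZ p hpg).getElem? hlt
    rw [((hY q hqf).of_prefix hpq).getElem? hlt] at h₁
    rw [Option.some.inj h₁]
    exact mem_functional_of_image (he i) hZ n
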